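/- Consider the Lorenz template in $\mathbb R^3$: the branched surface with branch set an interval $I$, on which a semi-flow leaves $I$, splits at a point $m\in I$, and returns to $I$. The orbit from $x\in I\setminus\{m\}$ to its first return $f(x)\in I$ goes around the left hole and in front if $x<m$, around the right hole and behind if $x>m$, and $f$ is strictly increasing on each of $I_1=\{x\in I: x<m\}$ and $I_2=\{x\in I: x>m\}$ (in a suitable coordinate on $I=[0,1]$ with $m=\tfrac12$, $f(x)=2x$ on $I_1$ and $f(x)=2x-1$ on $I_2$). A Lorenz knot is a periodic orbit $K$ of this semi-flow. Let $p_1<\dots<p_a$ be the points of $K\cap I_1$ and $q_b<\dots<q_1$ the points of $K\cap I_2$; $f$ permutes $K\cap I$. Let $t$ be the number of $i$ with $f(p_i)>m$ (it equals the number of $j$ with $f(q_j)<m$), and define $\mu_1<\dots<\mu_t$ and $\nu_1<\dots<\nu_t$ by $$\{p_1,\dots,p_a\}\cap f(\{q_b,\dots,q_1\})=\{p_{\mu_1},\dots,p_{\mu_t}\},\qquad \{q_b,\dots,q_1\}\cap f(\{p_1,\dots,p_a\})=\{q_{\nu_1},\dots,q_{\nu_t}\}.$$ **Theorem.** $K$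 is a knot, and its unknotting number $u(K)$ (the least number of crossing changes, over all diagrams of $K$, that turn the diagram into a diagram of the unknot) is finite and satisfies $$u(K)\;\le\;\tfrac12\Big((a+b)(t-1)-\sum_{i=1}^t\mu_i-\sum_{i=1}^t\nu_i+(t+1)\Big).$$ -/

import Mathlib

namespace LorenzKnots

/-! ### Polygonal knots in three-space -/

/-- Three-space, written as (projection plane) × (height). A point `((X, Y), Z)` projects to
`(X, Y)`; larger `Z` means nearer to the viewer. -/
abbrev Space : Type := (ℝ × ℝ) × ℝ

/-- The consecutive pairs of a cyclic list of vertices (the last vertex is joined to the first). -/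
def edges {α : Type} (l : List α) : List (α × α) := l.zip (l.rotate 1)

/-- The closed polygon with the given cyclic list of vertices, as a set of points. -/
def carrier (l : List Space) : Set Space :=
  {x | ∃ e ∈ edges l, x ∈ segment ℝ e.1 e.2}

/-- A cyclic list of vertices describes a polygonal knot: the closed polygon is simple, i.e. the
vertices are distinct and two different edges meet at most in a common end point. -/
def IsPolygonalKnot (l : List Space) : Prop :=
  3 ≤ l.length ∧ l.Nodup ∧
    ∀ e ∈ edges l, ∀ e' ∈ edges l, e ≠ e' →
      segment ℝ e.1 e.2 ∩ segment ℝ e'.1 e'.2 ⊆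
        ({e.1, e.2} : Set Space) ∩ ({e'.1, e'.2} : Set Space)

/-- The elementary (triangle) move: the edge `[p, q]` of a polygonal knot is replaced by the two
edges `[p, b]`, `[b, q]`, where the triangle `p b q` meets the knot in the edge `[p, q]` only and
the result is again a polygonal knot. If `b` lies on `[p, q]`, this subdivides the edge. -/
def DeltaMove (l l' : List Space) : Prop :=
  ∃ (p b q : Space) (r : List Space),
    l = p :: q :: r ∧ l' = p :: b :: q :: r ∧
    IsPolygonalKnot l ∧ IsPolygonalKnot l' ∧
    convexHull ℝ {p, b, q} ∩ carrier l ⊆ segment ℝ p q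

/-- Equivalence (isotopy) of polygonal knots: finitely many triangle moves and inverses of triangle
moves. Cyclic lists that differ by a rotation describe the same polygon. -/
def KnotEquiv : List Space → List Space → Prop :=
  Relation.EqvGen fun l l' => l' = l.rotate 1 ∨ DeltaMove l l'

/-- The unknot: equivalent to a (nondegenerate) triangle. -/
def IsUnknot (l : List Space) : Prop :=
  ∃ T : List Space, IsPolygonalKnot T ∧ T.length = 3 ∧ KnotEquiv l T

/-! ### Diagrams, crossing changes and the unknotting number -/

/-- The vertical projection of a closed polygon to the plane. -/
def shadow (l : List Space) : List (ℝ × ℝ) := l.map Prod.fst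

/-- A closed plane polygon is a regular projection: distinct vertices, no vertex on an edge of which
it is not an end point, and no point on three different edges. Hence its multiple points are finitely
many transverse double points, each interior to two edges. -/
def IsRegular (s : List (ℝ × ℝ)) : Prop :=
  s.Nodup ∧
  (∀ e ∈ edges s, ∀ p ∈ s, p ∈ segment ℝ e.1 e.2 → p = e.1 ∨ p = e.2) ∧
  (∀ e₁ ∈ edges s, ∀ e₂ ∈ edges s, ∀ e₃ ∈ edges s, e₁ ≠ e₂ → e₁ ≠ e₃ → e₂ ≠ e₃ →
    segment ℝ e₁.1 e₁.2 ∩ segment ℝ e₂.1 e₂.2 ∩ segment ℝ e₃.1 e₃.2 = ∅)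

/-- A knot diagram, given by a polygonal knot with regular projection: the shadow together with the
over/under information that the heights provide at the double points. -/
def IsDiagram (D : List Space) : Prop := IsPolygonalKnot D ∧ IsRegular (shadow D)

/-- Edge number `i` passes over edge number `j` at a crossing of the shadow. -/
def Over (D : List Space) (i j : ℕ) : Prop :=
  ∃ e ∈ (edges D)[i]?, ∃ e' ∈ (edges D)[j]?,
    ∃ p ∈ segment ℝ e.1 e.2, ∃ q ∈ segment ℝ e'.1 e'.2, p.1 = q.1 ∧ q.2 < p.2

/-- For two diagrams with the same shadow: the crossings at which over and under are exchanged.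
A crossing is recorded by the pair (upper edge in `D`, lower edge in `D`), so it occurs once. -/
def changedCrossings (D D' : List Space) : Set (ℕ × ℕ) :=
  {ij | Over D ij.1 ij.2 ∧ Over D' ij.2 ij.1}

/-- `K` has a diagram from which a diagram of the unknot is obtained by changing exactly `k`
crossings. -/
def UnknotsWith (K : List Space) (k : ℕ) : Prop :=
  ∃ D D' : List Space,
    KnotEquiv K D ∧ IsDiagram D ∧ IsDiagram D' ∧ shadow D' = shadow D ∧
    (changedCrossings D D').ncard = k ∧ IsUnknot D'

/-- The unknotting number: the least number of crossing changes, over all diagrams of the knot, that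
turn the diagram into one of the unknot. (It would be `⊤` if no number of changes sufficed.) -/
noncomputable def unknottingNumber (K : List Space) : ℕ∞ :=
  ⨅ k ∈ {k : ℕ | UnknotsWith K k}, (k : ℕ∞)

/-! ### Lorenz knots

The branch set of the Lorenz template is placed at `I = {((x, 0), 0) : 0 ≤ x ≤ 1}`, with `m = 1/2`. -/

/-- The first return map on the branch set, in the coordinate in which both branches are linear:
each of `[0, 1/2)` and `(1/2, 1]` is stretched monotonically over the branch set, the itinerary of a
point being its binary expansion (`x` for the digit 0 and `y` for the digit 1). At the point `m = 1/2`,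
where the flow never returns, the value `0`, a fixed point, is put by convention, so that no periodic
orbit meets `m`. -/
noncomputable def returnMap (x : ℝ) : ℝ := if x < 1 / 2 then 2 * x else 2 * x - 1

/-- The vertices, in the order of the flow, of the orbit arc of the template from the point `x` of the
branch set to its first return; the end point `((returnMap x, 0), 0)` itself is left out. The flow
leaves the branch set downwards. For `x < 1/2` the arc turns around the left hole, and comes down to
the branch set in front (height from `1` to `0`); for `x > 1/2` it turns around the right hole, and
comes down behind (height from `-1` to `0`). The arcs of each of the two ears are nested, so that
projections of arcs cross only in the strip `0 < Y < 1`, between arcs of different ears. -/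
noncomputable def returnArc (x : ℝ) : List Space :=
  if x < 1 / 2 then
    [((x, 0), 0), ((x, -1 - x), 0), ((-2 - x, -1 - x), 0),
      ((-2 - x, 2 + x), 1), ((x, 2 + x), 1), ((x, 1), 1)]
  else
    [((x, 0), 0), ((x, x - 2), 0), ((4 - x, x - 2), 0),
      ((4 - x, 3 - x), -1), ((x, 3 - x), -1), ((x, 1), -1)]

/-- The Lorenz knot through the periodic point `x` of the return map: the periodic orbit of the flow
on the template, followed once around. -/
noncomputable def lorenzKnot (x : ℝ) : List Space :=
  (List.range (Function.minimalPeriod returnMap x)).flatMap fun i => returnArc (returnMap^[i] x)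

/-- The intersection points of the periodic orbit of `x` with the branch set. -/
noncomputable def orbitPoints (x : ℝ) : Finset ℝ :=
  (Finset.range (Function.minimalPeriod returnMap x)).image fun i => returnMap^[i] x

/-- The intersection points `p₁ < … < p_a` to the left of `m`. -/
noncomputable def leftPoints (x : ℝ) : Finset ℝ := (orbitPoints x).filter fun z => z < 1 / 2

/-- The intersection points `q_b < … < q₁` to the right of `m`. -/
noncomputable def rightPoints (x : ℝ) : Finset ℝ := (orbitPoints x).filter fun z => 1 / 2 < z

/-- The number `a` of letters `x` in the word of the orbit. -/
noncomputable def numLeft (x : ℝ) : ℕ := (leftPoints x).card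

/-- The number `b` of letters `y` in the word of the orbit. -/
noncomputable def numRight (x : ℝ) : ℕ := (rightPoints x).card

/-- The trip number `t`: the number of strands that go from the left to the right. -/
noncomputable def tripNumber (x : ℝ) : ℕ :=
  ((leftPoints x).filter fun p => returnMap p ∈ rightPoints x).card

/-- The set `{μ₁ < … < μ_t}` of the indices `j`, counted from the left end and starting with `1`, of
those `p_j` at which a strand from the right arrives. -/
noncomputable def muIndices (x : ℝ) : Finset ℕ :=
  (leftPoints x ∩ (rightPoints x).image returnMap).image
    fun p => ((leftPoints x).filter fun p' => p' ≤ p).card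

/-- The set `{ν₁ < … < ν_t}` of the indices `j`, counted from the right end and starting with `1`, of
those `q_j` at which a strand from the left arrives. -/
noncomputable def nuIndices (x : ℝ) : Finset ℕ :=
  (rightPoints x ∩ (leftPoints x).image returnMap).image
    fun q => ((rightPoints x).filter fun q' => q ≤ q').card

end LorenzKnots

/-!
The shadow of the polygonal orbit `lorenzKnot x` is already a regular projection: two edges have
shadows that meet only if the edges are consecutive or if they lie in the strip `0 < Y < 1` and
belong to a left and a right point of the orbit (`meet`, `isDiagram_lorenzKnot`). The strands from the
left never cross each other, nor do those from the right, so there are no triple points. At a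
crossing the strand from the left is on top.

In this diagram the crossings are changed so that it becomes descending from the leftmost point of
the orbit: at each crossing the strand visited first is put on top. A descending polygon, closed up
by one steep edge, is unknotted, because its second vertex can be cut off by a triangle move as
long as there are more than three vertices (`Descends.deltaMove`, `Descends.isUnknot`,
`exists_descends`).

It remains to count. Let `x₀, …, x_{n-1}` be the orbit, with `x₀` leftmost. The crossings to be
changed are the pairs `i < j` for which the strand from `x_i` comes from the right, that from `x_j`
from the left, and they cross (`badPairs`). If `g i j` is the truth value of `x_i < x_j`, then
`g i j - g (i + 1) (j + 1)` is `1` for a crossing that is kept, `-1` for a crossing that is changed and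
`0` otherwise. The sum over `i < j < n` telescopes to
`#{j ≠ 0 | x₀ < x_j} - #{i ≠ 0 | x_i < x₀} = n - 1`, so that among the `c` crossings exactly
`(c - n + 1) / 2` are changed (`two_mul_card_badPairs`). Finally, a strand from the left crosses as many
strands as the number of places by which it moves to the right, and summing these displacements
gives `c = t (n + 1) - ∑ μ_i - ∑ ν_i` (`crossings_eq`).
-/

namespace LorenzKnots

open Function

/-! ### Descending polygons -/

theorem snd_mem_of_mem_segment {a c x : Space} (h : c.2 < a.2) (hx : x ∈ segment ℝ a c) :
    c.2 ≤ x.2 ∧ x.2 ≤ a.2 ∧ (x.2 = a.2 → x = a) ∧ (x.2 = c.2 → x = c) := by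
  rw [segment_eq_image'] at hx
  obtain ⟨u, ⟨h0, h1⟩, rfl⟩ := hx
  have e : (a + u • (c - a)).2 = a.2 + u * (c.2 - a.2) := by simp
  simp only [e]
  refine ⟨by nlinarith, by nlinarith, fun h' => ?_, fun h' => ?_⟩
  · have : u = 0 := by
      have : u * (c.2 - a.2) = 0 := by linarith
      rcases mul_eq_zero.1 this with h | h
      · exact h
      · linarith
    simp [this]
  · have : u = 1 := by
      have : (u - 1) * (c.2 - a.2) = 0 := by linarith
      rcases mul_eq_zero.1 this with h | h
      · linarith
      · linarith
    simp [this]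

/-- As seen from `p`, the point `e` is in general position with respect to the segment `[b, c]`: no
line through `p` and a point of `[b, c]` contains `e`. -/
def Unseen (p e b c : Space) : Prop := ∀ t ∈ segment ℝ b c, ∀ r : ℝ, r • (t - p) ≠ e - p

theorem edges_closed (p e : Space) (m : List Space) :
    edges (p :: m ++ [e]) = (p :: m).zip (m ++ [e]) ++ [(e, p)] := by
  unfold edges
  rw [List.cons_append, List.rotate_cons_succ, List.rotate_zero, ← List.cons_append,
    List.zip_append (by simp)]
  simp

theorem chain_edge_height {p e : Space} {m : List Space}
    (h : (p :: m ++ [e]).Pairwise fun a b => b.2 < a.2) {a c : Space}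
    (hac : (a, c) ∈ (p :: m).zip (m ++ [e])) : c.2 < a.2 ∧ a.2 ≤ p.2 ∧ e.2 ≤ c.2 := by
  induction m generalizing p with
  | nil =>
    simp at hac h
    obtain ⟨rfl, rfl⟩ := hac
    exact ⟨h, le_rfl, le_rfl⟩
  | cons b r ih =>
    rw [List.cons_append, List.cons_append, List.pairwise_cons] at h
    simp only [List.cons_append, List.zip_cons_cons, List.mem_cons, Prod.mk.injEq] at hac
    rcases hac with ⟨rfl, rfl⟩ | hac
    · refine ⟨h.1 _ (by simp), le_rfl, ?_⟩
      have := List.pairwise_cons.1 h.2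
      exact (this.1 e (by simp)).le
    · obtain ⟨h1, h2, h3⟩ := ih h.2 hac
      exact ⟨h1, h2.trans (h.1 b (by simp)).le, h3⟩

/-- Two edges of a descending path lie in height intervals with at most an end point in common. -/
theorem chain_edges_inter {p e : Space} {m : List Space}
    (h : (p :: m ++ [e]).Pairwise fun a b => b.2 < a.2) {ε δ : Space × Space}
    (hε : ε ∈ (p :: m).zip (m ++ [e])) (hδ : δ ∈ (p :: m).zip (m ++ [e])) (hne : ε ≠ δ) :
    segment ℝ ε.1 ε.2 ∩ segment ℝ δ.1 δ.2 ⊆ ({ε.1, ε.2} : Set Space) ∩ {δ.1, δ.2} := by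
  induction m generalizing p with
  | nil =>
    simp at hε hδ
    exact absurd (hε.trans hδ.symm) hne
  | cons b r ih =>
    rw [List.cons_append, List.cons_append, List.pairwise_cons] at h
    have first : ∀ δ ∈ (b :: r).zip (r ++ [e]),
        segment ℝ p b ∩ segment ℝ δ.1 δ.2 ⊆ ({p, b} : Set Space) ∩ {δ.1, δ.2} := by
      rintro ⟨a, c⟩ hac x ⟨hx, hx'⟩
      obtain ⟨h1, h2, h3⟩ := chain_edge_height h.2 hac
      obtain ⟨k1, k2, k3, k4⟩ := snd_mem_of_mem_segment (h.1 b (by simp)) hx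
      obtain ⟨l1, l2, l3, l4⟩ := snd_mem_of_mem_segment h1 hx'
      dsimp only at *
      exact ⟨Or.inr (k4 (by linarith)), Or.inl (l3 (by linarith))⟩
    simp only [List.cons_append, List.zip_cons_cons, List.mem_cons] at hε hδ
    rcases hε with rfl | hε <;> rcases hδ with rfl | hδ
    · exact absurd rfl hne
    · exact first _ hδ
    · rw [Set.inter_comm, Set.inter_comm {ε.1, ε.2}]
      exact first _ hε
    · exact ih h.2 hε hδ

theorem mem_zip_of_isChain {R : Space → Space → Prop} {e b : Space} {r : List Space}
    (h : (b :: r).IsChain R) {a c : Space} (hac : (a, c) ∈ (b :: r).zip (r ++ [e])) :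
    a ∈ b :: r ∧ (R a c ∨ c = e) := by
  induction r generalizing b with
  | nil =>
    simp at hac
    simp [hac]
  | cons d r ih =>
    rw [List.isChain_cons_cons] at h
    simp only [List.cons_append, List.zip_cons_cons, List.mem_cons, Prod.mk.injEq] at hac
    rcases hac with ⟨rfl, rfl⟩ | hac
    · exact ⟨by simp, Or.inl h.1⟩
    · have := ih h.2 hac
      exact ⟨List.mem_cons_of_mem _ this.1, this.2⟩

/-- The polygon with vertices `p`, the list `m`, and `e` is descending from `p` to `e`, and the
closing edge `[e, p]` is in general position with respect to the edges not incident to `p` or `e`. -/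
structure Descends (p e : Space) (m : List Space) : Prop where
  ne_nil : m ≠ []
  height : (p :: m ++ [e]).Pairwise fun a b => b.2 < a.2
  vertex : ∀ b ∈ m, ∀ r : ℝ, r • (b - p) ≠ e - p
  chain : m.IsChain (Unseen p e)

theorem Descends.tail {p e b c : Space} {r : List Space} (h : Descends p e (b :: c :: r)) :
    Descends p e (c :: r) where
  ne_nil := by simp
  height := h.height.sublist (by simp)
  vertex d hd := h.vertex d (List.mem_cons_of_mem _ hd)
  chain := (List.isChain_cons_cons.1 h.chain).2

/-- The closing edge of a descending polygon meets the other edges in common end points only. -/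
theorem Descends.closing_inter {p e : Space} {m : List Space} (h : Descends p e m)
    {δ : Space × Space} (hδ : δ ∈ (p :: m).zip (m ++ [e])) :
    segment ℝ e p ∩ segment ℝ δ.1 δ.2 ⊆ ({e, p} : Set Space) ∩ {δ.1, δ.2} := by
  obtain ⟨a, c⟩ := δ
  obtain ⟨b, r, rfl⟩ := List.exists_cons_of_ne_nil h.ne_nil
  have hh := h.height
  rw [List.cons_append, List.cons_append, List.pairwise_cons] at hh
  rintro x ⟨hx, hx'⟩
  rw [segment_symm, segment_eq_image'] at hx
  obtain ⟨s, ⟨hs0, hs1⟩, rfl⟩ := hx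
  simp only [List.cons_append, List.zip_cons_cons, List.mem_cons, Prod.mk.injEq] at hδ
  rcases hδ with ⟨rfl, rfl⟩ | hδ
  · rcases eq_or_ne s 0 with rfl | hs
    · simp
    · exfalso
      rw [segment_eq_image'] at hx'
      obtain ⟨u, -, hu⟩ := hx'
      have hu' : u • (c - a) = s • (e - a) := add_left_cancel hu
      refine h.vertex c (by simp) (s⁻¹ * u) ?_
      rw [mul_smul, hu', inv_smul_smul₀ hs]
  · have hmem := mem_zip_of_isChain h.chain hδ
    have hheight := chain_edge_height hh.2 hδ
    have hpa : a.2 < p.2 := lt_of_le_of_lt hheight.2.1 (hh.1 b (by simp))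
    have hk := snd_mem_of_mem_segment hheight.1 hx'
    have hs : s ≠ 0 := by
      rintro rfl
      simp at hk
      linarith [hk.2.1]
    rcases hmem.2 with hR | rfl
    · exfalso
      refine hR _ hx' s⁻¹ ?_
      rw [add_sub_cancel_left, inv_smul_smul₀ hs]
    · rw [segment_eq_image'] at hx'
      obtain ⟨u, -, hu⟩ := hx'
      rcases eq_or_ne u 1 with rfl | hu1
      · have : c = p + s • (c - p) := by simpa using hu
        show p + s • (c - p) ∈ _
        rw [← this]
        simp
      · exfalso
        have hu' : (1 - u) • (a - p) = (s - u) • (c - p) := by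
          have : a + u • (c - a) = p + s • (c - p) := hu
          linear_combination (norm := module) this
        have hsu : s - u ≠ 0 := by
          intro h0
          rw [h0, zero_smul, smul_eq_zero] at hu'
          rcases hu' with h' | h'
          · exact hu1 (by linarith)
          · rw [sub_eq_zero.1 h'] at hpa
            exact lt_irrefl _ hpa
        refine h.vertex a hmem.1 ((s - u)⁻¹ * (1 - u)) ?_
        rw [mul_smul, hu', inv_smul_smul₀ hsu]

theorem Descends.isPolygonalKnot {p e : Space} {m : List Space} (h : Descends p e m) :
    IsPolygonalKnot (p :: m ++ [e]) := by
  refine ⟨?_, ?_, ?_⟩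
  · have := List.length_pos_of_ne_nil h.ne_nil
    simp
    omega
  · exact h.height.imp fun hab => by rintro rfl; exact lt_irrefl _ hab
  · intro ε hε δ hδ hne
    rw [edges_closed, List.mem_append, List.mem_singleton] at hε hδ
    rcases hε with hε | rfl <;> rcases hδ with hδ | rfl
    · exact chain_edges_inter h.height hε hδ hne
    · rw [Set.inter_comm, Set.inter_comm {ε.1, ε.2}]
      exact h.closing_inter hε
    · exact h.closing_inter hδ
    · exact absurd rfl hne

/-- The second vertex of a descending polygon can be cut off by a triangle move: the rest of the
descending path lies below the triangle, and the closing edge leaves the triangle at `p`. -/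
theorem Descends.deltaMove {p e b c : Space} {r : List Space} (h : Descends p e (b :: c :: r)) :
    DeltaMove (p :: c :: r ++ [e]) (p :: b :: c :: r ++ [e]) := by
  refine ⟨p, b, c, r ++ [e], by simp, by simp, h.tail.isPolygonalKnot, h.isPolygonalKnot, ?_⟩
  rintro x ⟨hx, ε, hε, hxε⟩
  have hh := h.height
  rw [List.cons_append, List.cons_append, List.pairwise_cons] at hh
  have hpb : b.2 < p.2 := hh.1 b (by simp)
  have hbc : c.2 < b.2 := (List.pairwise_cons.1 hh.2).1 c (by simp)
  rw [convexHull_insert (by simp), convexHull_pair, mem_convexJoin] at hx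
  obtain ⟨p', hp', t, ht, hxt⟩ := hx
  obtain rfl : p' = p := hp'
  have htk := snd_mem_of_mem_segment hbc ht
  have hxk := snd_mem_of_mem_segment (by linarith : t.2 < p'.2) hxt
  rw [edges_closed, List.mem_append, List.mem_singleton] at hε
  rcases hε with hε | rfl
  · simp only [List.cons_append, List.zip_cons_cons, List.mem_cons] at hε
    rcases hε with rfl | hε
    · exact hxε
    · have hd := chain_edge_height (List.pairwise_cons.1 hh.2).2 hε
      have hk := snd_mem_of_mem_segment hd.1 hxε
      have h1 : x = t := hxk.2.2.2 (by linarith)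
      have h2 : t = c := htk.2.2.2 (by rw [← h1]; linarith)
      rw [h1, h2]
      exact right_mem_segment ℝ _ _
  · rw [segment_symm, segment_eq_image'] at hxε
    obtain ⟨s, -, rfl⟩ := hxε
    rcases eq_or_ne s 0 with rfl | hs
    · simp [left_mem_segment]
    · exfalso
      rw [segment_eq_image'] at hxt
      obtain ⟨u, -, hu⟩ := hxt
      have hu' : u • (t - p') = s • (e - p') := add_left_cancel hu
      refine (List.isChain_cons_cons.1 h.chain).1 t ht (s⁻¹ * u) ?_
      rw [mul_smul, hu', inv_smul_smul₀ hs]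

theorem Descends.isUnknot {p e : Space} {m : List Space} (h : Descends p e m) :
    IsUnknot (p :: m ++ [e]) := by
  induction m with
  | nil => exact absurd rfl h.ne_nil
  | cons b r ih =>
    cases r with
    | nil => exact ⟨_, h.isPolygonalKnot, rfl, Relation.EqvGen.refl _⟩
    | cons c r =>
      obtain ⟨T, hT, hT3, hequiv⟩ := ih h.tail
      exact ⟨T, hT, hT3, .trans _ _ _ (.symm _ _ (.rel _ _ (Or.inr h.deltaMove))) hequiv⟩

theorem fst_mem_segment {a c x : Space} (hx : x ∈ segment ℝ a c) : x.1 ∈ segment ℝ a.1 c.1 :=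
  (Prod.segment_subset a c hx).1

/-- Heights of a descending polygon over a plane polygon: the vertex number `i < N - 1` is at the
height `-i`, and the last vertex is at the height `-H`. -/
def descendingVertex (N : ℕ) (S : ℕ → ℝ × ℝ) (H : ℝ) (i : ℕ) : Space :=
  (S i, if i + 1 = N then -H else -(i : ℝ))

/-- Over any plane polygon that does not return to its initial vertex there is a descending polygon
which is an unknot. It suffices to place the last vertex so low that the closing edge
is too steep to meet the cone from the initial vertex over one of the edges. -/
theorem exists_descends (N : ℕ) (hN : 3 ≤ N) (S : ℕ → ℝ × ℝ)
    (hS : ∀ i, 1 ≤ i → i + 1 < N → S 0 ∉ segment ℝ (S i) (S (i + 1))) :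
    ∃ H : ℝ, (N : ℝ) ≤ H ∧
      IsPolygonalKnot ((List.range N).map (descendingVertex N S H)) ∧
      IsUnknot ((List.range N).map (descendingVertex N S H)) := by
  obtain ⟨n, rfl⟩ : ∃ n, N = n + 2 := ⟨N - 2, by omega⟩
  set N := n + 2 with hNdef
  have hN0 : (0 : ℝ) < N := by positivity
  set C : Set (ℝ × ℝ) := ⋃ i ∈ Set.Icc 1 n, segment ℝ (S i) (S (i + 1)) with hC
  have hCc : IsClosed C := by
    refine (Set.finite_Icc 1 n).isClosed_biUnion fun i _ => ?_
    rw [← convexHull_pair (𝕜 := ℝ)]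
    exact ((Set.toFinite _).isCompact_convexHull (𝕜 := ℝ)).isClosed
  have hSC : S 0 ∈ Cᶜ := by
    simp only [hC, Set.mem_compl_iff, Set.mem_iUnion, not_exists]
    exact fun i hi => hS i hi.1 (by have := hi.2; omega)
  obtain ⟨δ, hδ, hball⟩ := Metric.isOpen_iff.1 hCc.isOpen_compl _ hSC
  have hfar : ∀ t ∈ C, δ ≤ ‖t - S 0‖ := by
    intro t ht
    by_contra! hlt
    exact hball (by rwa [Metric.mem_ball, dist_eq_norm]) ht
  set w := ‖S (n + 1) - S 0‖ with hw
  have hw0 : 0 ≤ w := norm_nonneg _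
  set H : ℝ := N + w * N / δ with hH
  have hHN : (N : ℝ) ≤ H := by
    have : 0 ≤ w * N / δ := by positivity
    linarith
  have hHw : w * N < H * δ := by
    rw [hH, add_mul, div_mul_cancel₀ _ hδ.ne']
    nlinarith
  refine ⟨H, hHN, ?_⟩
  set v := descendingVertex N S H with hv
  have hlast : v (n + 1) = (S (n + 1), -H) := by simp [hv, descendingVertex, hNdef]
  have hlow : ∀ i, i ≤ n → v i = (S i, -(i : ℝ)) := by
    intro i hi
    have : i + 1 ≠ N := by omega
    simp [hv, descendingVertex, this]
  have hlist : (List.range N).map v = v 0 :: (List.range' 1 n).map v ++ [v (n + 1)] := by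
    rw [hNdef, List.range_succ, List.map_append, List.range_eq_range', List.range'_succ]
    simp
  rw [hlist]
  suffices h : Descends (v 0) (v (n + 1)) ((List.range' 1 n).map v) from
    ⟨h.isPolygonalKnot, h.isUnknot⟩
  -- A point over `C` at a height in `[-N, N]` is not on the steep line through the closing edge.
  have steep : ∀ t : Space, t.1 ∈ C → |t.2| ≤ N → ∀ r : ℝ, r • (t - v 0) ≠ v (n + 1) - v 0 := by
    intro t ht h1 r hr
    rw [hlast, hlow 0 (by omega)] at hr
    have e1 : r • (t.1 - S 0) = S (n + 1) - S 0 := congrArg Prod.fst hr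
    have e2 : r * t.2 = -H := by simpa using congrArg Prod.snd hr
    have e3 : |r| * ‖t.1 - S 0‖ = w := by rw [hw, ← e1, norm_smul, Real.norm_eq_abs]
    have e4 := hfar _ ht
    have e5 : |r| * δ ≤ w := by rw [← e3]; gcongr
    have e6 : H ≤ |r| * N := by
      have : H ≤ |r * t.2| := by rw [e2, abs_neg]; exact le_abs_self H
      rw [abs_mul] at this
      exact this.trans (by gcongr)
    nlinarith
  constructor
  · simp
    omega
  · rw [← hlist, List.pairwise_map]
    refine List.Pairwise.imp_of_mem ?_ List.pairwise_lt_range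
    intro i j hi hj hij
    rw [List.mem_range] at hi hj
    have hij' : (i : ℝ) < j := by exact_mod_cast hij
    rw [hlow i (by omega)]
    rcases Nat.lt_or_ge n j with hj' | hj'
    · obtain rfl : j = n + 1 := by omega
      rw [hlast]
      have : (i : ℝ) < N := by exact_mod_cast hi
      simp only
      linarith
    · rw [hlow j hj']
      simpa using hij
  · intro b hb
    simp only [List.mem_map, List.mem_range'_1] at hb
    obtain ⟨i, hi, rfl⟩ := hb
    rw [hlow i (by omega)]
    refine steep _ (Set.mem_biUnion (x := i) ⟨hi.1, by omega⟩ (left_mem_segment ℝ _ _)) ?_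
    have : (i : ℝ) ≤ N := by exact_mod_cast (by omega : i ≤ N)
    simpa using this
  · rw [List.isChain_iff_getElem]
    intro i hi t ht
    simp only [List.length_map, List.length_range'] at hi
    simp only [List.getElem_map, List.getElem_range', one_mul] at ht
    have hi1 : ((1 + i : ℕ) : ℝ) ≤ N := by exact_mod_cast (by omega : 1 + i ≤ N)
    have hi2 : ((1 + (i + 1) : ℕ) : ℝ) ≤ N := by exact_mod_cast (by omega : 1 + (i + 1) ≤ N)
    rw [hlow _ (by omega), hlow _ (by omega)] at ht
    refine steep _ (Set.mem_biUnion (x := 1 + i) ⟨by omega, by omega⟩ (fst_mem_segment ht)) ?_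
    have hk := snd_mem_of_mem_segment (by push_cast; linarith) ht
    dsimp only at hk
    have hi0 : (0 : ℝ) ≤ ((1 + i : ℕ) : ℝ) := Nat.cast_nonneg _
    rw [abs_le]
    constructor <;> linarith [hk.1, hk.2.1]

/-! ### The edges of a Lorenz knot -/

/-- The vertex number `k < 6` of the return arc from `z`. -/
noncomputable def arcVertex (z : ℝ) (k : ℕ) : Space := (returnArc z).getD k 0

/-- The vertex after the vertex number `k < 6` of the return arc from `z`. For `k = 5` it is the end
point of the arc, on the branch set. -/
noncomputable def arcNext (z : ℝ) (k : ℕ) : Space :=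
  if k = 5 then arcVertex (returnMap z) 0 else arcVertex z (k + 1)

/-- The points of the branch set outside the fold point `m = 1/2`. -/
def branchSet : Set ℝ := {z | 0 ≤ z ∧ z ≤ 1 ∧ z ≠ 1 / 2}

theorem arcVertex_zero (z : ℝ) : arcVertex z 0 = ((z, 0), 0) := by
  unfold arcVertex returnArc
  split_ifs <;> rfl

theorem returnArc_left {z : ℝ} (hz : z < 1 / 2) : returnArc z =
    [((z, 0), 0), ((z, -1 - z), 0), ((-2 - z, -1 - z), 0),
      ((-2 - z, 2 + z), 1), ((z, 2 + z), 1), ((z, 1), 1)] := if_pos hz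

theorem returnArc_right {z : ℝ} (hz : 1 / 2 < z) : returnArc z =
    [((z, 0), 0), ((z, z - 2), 0), ((4 - z, z - 2), 0),
      ((4 - z, 3 - z), -1), ((z, 3 - z), -1), ((z, 1), -1)] := if_neg hz.not_gt

/-- The equations and inequalities that hold on the shadows of the six edges of a left arc. -/
theorem left_edge {z : ℝ} (hz : z < 1 / 2) (h0 : 0 ≤ z) {k : ℕ} (hk : k < 6) {P : ℝ × ℝ}
    (hP : P ∈ segment ℝ (arcVertex z k).1 (arcNext z k).1) :
    (k = 0 ∧ P.1 = z ∧ -1 - z ≤ P.2 ∧ P.2 ≤ 0) ∨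
    (k = 1 ∧ P.2 = -1 - z ∧ -2 - z ≤ P.1 ∧ P.1 ≤ z) ∨
    (k = 2 ∧ P.1 = -2 - z ∧ -1 - z ≤ P.2 ∧ P.2 ≤ 2 + z) ∨
    (k = 3 ∧ P.2 = 2 + z ∧ -2 - z ≤ P.1 ∧ P.1 ≤ z) ∨
    (k = 4 ∧ P.1 = z ∧ 1 ≤ P.2 ∧ P.2 ≤ 2 + z) ∨
    (k = 5 ∧ P.1 = z * (2 - P.2) ∧ 0 ≤ P.2 ∧ P.2 ≤ 1) := by
  rw [segment_eq_image'] at hP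
  obtain ⟨u, ⟨hu0, hu1⟩, rfl⟩ := hP
  have hf : returnMap z = 2 * z := if_pos hz
  interval_cases k
  · left; simp [arcVertex, arcNext, returnArc_left hz]; constructor <;> nlinarith
  · right; left; simp [arcVertex, arcNext, returnArc_left hz]; constructor <;> nlinarith
  · right; right; left; simp [arcVertex, arcNext, returnArc_left hz]; constructor <;> nlinarith
  · right; right; right; left; simp [arcVertex, arcNext, returnArc_left hz]; constructor <;> nlinarith
  · right; right; right; right; left
    simp [arcVertex, arcNext, returnArc_left hz]; constructor <;> nlinarith
  · right; right; right; right; right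
    simp only [arcNext, if_true, arcVertex_zero]
    simp [arcVertex, returnArc_left hz, hf, hu0, hu1]; ring

/-- The equations and inequalities that hold on the shadows of the six edges of a right arc. -/
theorem right_edge {z : ℝ} (hz : 1 / 2 < z) (h1 : z ≤ 1) {k : ℕ} (hk : k < 6) {P : ℝ × ℝ}
    (hP : P ∈ segment ℝ (arcVertex z k).1 (arcNext z k).1) :
    (k = 0 ∧ P.1 = z ∧ z - 2 ≤ P.2 ∧ P.2 ≤ 0) ∨
    (k = 1 ∧ P.2 = z - 2 ∧ z ≤ P.1 ∧ P.1 ≤ 4 - z) ∨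
    (k = 2 ∧ P.1 = 4 - z ∧ z - 2 ≤ P.2 ∧ P.2 ≤ 3 - z) ∨
    (k = 3 ∧ P.2 = 3 - z ∧ z ≤ P.1 ∧ P.1 ≤ 4 - z) ∨
    (k = 4 ∧ P.1 = z ∧ 1 ≤ P.2 ∧ P.2 ≤ 3 - z) ∨
    (k = 5 ∧ P.1 = z * (2 - P.2) - (1 - P.2) ∧ 0 ≤ P.2 ∧ P.2 ≤ 1) := by
  rw [segment_eq_image'] at hP
  obtain ⟨u, ⟨hu0, hu1⟩, rfl⟩ := hP
  have hf : returnMap z = 2 * z - 1 := if_neg hz.not_gt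
  interval_cases k
  · left; simp [arcVertex, arcNext, returnArc_right hz]; constructor <;> nlinarith
  · right; left; simp [arcVertex, arcNext, returnArc_right hz]; constructor <;> nlinarith
  · right; right; left; simp [arcVertex, arcNext, returnArc_right hz]; constructor <;> nlinarith
  · right; right; right; left; simp [arcVertex, arcNext, returnArc_right hz]; constructor <;> nlinarith
  · right; right; right; right; left
    simp [arcVertex, arcNext, returnArc_right hz]; constructor <;> nlinarith
  · right; right; right; right; right
    simp only [arcNext, if_true, arcVertex_zero]
    simp [arcVertex, returnArc_right hz, hf, hu0, hu1]; ring

theorem left_strip_height {z : ℝ} (hz : z < 1 / 2) {p : Space}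
    (hp : p ∈ segment ℝ (arcVertex z 5) (arcNext z 5)) : p.2 = p.1.2 := by
  rw [segment_eq_image'] at hp
  obtain ⟨u, ⟨hu0, hu1⟩, rfl⟩ := hp
  simp only [arcNext, if_true, arcVertex_zero]
  simp [arcVertex, returnArc_left hz]

theorem right_strip_height {z : ℝ} (hz : 1 / 2 < z) {p : Space}
    (hp : p ∈ segment ℝ (arcVertex z 5) (arcNext z 5)) : p.2 = -p.1.2 := by
  rw [segment_eq_image'] at hp
  obtain ⟨u, ⟨hu0, hu1⟩, rfl⟩ := hp
  simp only [arcNext, if_true, arcVertex_zero]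
  simp [arcVertex, returnArc_right hz]
  ring

/-- The shadow of the strip edge of the left point `z` crosses that of the right point `z'`. -/
structure StripCrossing (z : ℝ) (k : ℕ) (z' : ℝ) (k' : ℕ) (P : ℝ × ℝ) : Prop where
  left_strip : k = 5
  right_strip : k' = 5
  pos : 0 < P.2
  lt_one : P.2 < 1
  left : z < 1 / 2
  right : 1 / 2 < z'
  reverses : returnMap z' < returnMap z

/-- The edge number `k'` of the arc from `z'` starts at the end of the edge number `k` of the arc
from `z`, over the point `P`. -/
def Follows (z : ℝ) (k : ℕ) (z' : ℝ) (k' : ℕ) (P : ℝ × ℝ) : Prop :=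
  P = (arcNext z k).1 ∧ arcNext z k = arcVertex z' k'

theorem meet_left_left {z z' : ℝ} (hz : z < 1 / 2) (hz' : z' < 1 / 2) (h0 : 0 ≤ z) (h0' : 0 ≤ z')
    {k k' : ℕ} (hk : k < 6) (hk' : k' < 6) (hkk : k ≤ k') {P : ℝ × ℝ}
    (hP : P ∈ segment ℝ (arcVertex z k).1 (arcNext z k).1)
    (hP' : P ∈ segment ℝ (arcVertex z' k').1 (arcNext z' k').1) :
    (z = z' ∧ k = k') ∨ Follows z k z' k' P ∨ Follows z' k' z k P := by
  have hf : returnMap z' = 2 * z' := if_pos hz'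
  obtain ⟨X, Y⟩ := P
  rcases left_edge hz h0 hk hP with ⟨rfl, h⟩ | ⟨rfl, h⟩ | ⟨rfl, h⟩ | ⟨rfl, h⟩ | ⟨rfl, h⟩ | ⟨rfl, h⟩ <;>
  rcases left_edge hz' h0' hk' hP' with
    ⟨rfl, h'⟩ | ⟨rfl, h'⟩ | ⟨rfl, h'⟩ | ⟨rfl, h'⟩ | ⟨rfl, h'⟩ | ⟨rfl, h'⟩ <;>
  clear hP hP' <;> obtain ⟨e1, e2, e3⟩ := h <;> obtain ⟨e1', e2', e3'⟩ := h' <;> dsimp only at * <;>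
  first
  | (exfalso; omega)
  | (exfalso; linarith)
  | (exfalso; nlinarith)
  | (left; exact ⟨by linarith, rfl⟩)
  | (left; exact ⟨by nlinarith, rfl⟩)
  | (right; left
     have hzz : z = z' := by linarith
     subst hzz
     simp [Follows, arcVertex, arcNext, returnArc_left hz]
     constructor <;> linarith)
  | (right; left
     have hY : Y = 1 := by linarith
     subst hY
     have hzz : z = z' := by linarith
     subst hzz
     simp [Follows, arcVertex, arcNext, returnArc_left hz]
     linarith)
  | (right; right
     have hY : Y = 0 := by linarith
     subst hY
     have : returnMap z' = z := by linarith
     simp [Follows, arcNext, arcVertex_zero, this]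
     linarith)


theorem meet_right_right {z z' : ℝ} (hz : 1 / 2 < z) (hz' : 1 / 2 < z') (h1 : z ≤ 1) (h1' : z' ≤ 1)
    {k k' : ℕ} (hk : k < 6) (hk' : k' < 6) (hkk : k ≤ k') {P : ℝ × ℝ}
    (hP : P ∈ segment ℝ (arcVertex z k).1 (arcNext z k).1)
    (hP' : P ∈ segment ℝ (arcVertex z' k').1 (arcNext z' k').1) :
    (z = z' ∧ k = k') ∨ Follows z k z' k' P ∨ Follows z' k' z k P := by
  have hf : returnMap z' = 2 * z' - 1 := if_neg hz'.not_gt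
  obtain ⟨X, Y⟩ := P
  rcases right_edge hz h1 hk hP with
    ⟨rfl, h⟩ | ⟨rfl, h⟩ | ⟨rfl, h⟩ | ⟨rfl, h⟩ | ⟨rfl, h⟩ | ⟨rfl, h⟩ <;>
  rcases right_edge hz' h1' hk' hP' with
    ⟨rfl, h'⟩ | ⟨rfl, h'⟩ | ⟨rfl, h'⟩ | ⟨rfl, h'⟩ | ⟨rfl, h'⟩ | ⟨rfl, h'⟩ <;>
  clear hP hP' <;> obtain ⟨e1, e2, e3⟩ := h <;> obtain ⟨e1', e2', e3'⟩ := h' <;> dsimp only at * <;>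
  first
  | (exfalso; omega)
  | (exfalso; linarith)
  | (exfalso; nlinarith)
  | (left; exact ⟨by linarith, rfl⟩)
  | (left; exact ⟨by nlinarith, rfl⟩)
  | (right; left
     have hzz : z = z' := by linarith
     subst hzz
     simp [Follows, arcVertex, arcNext, returnArc_right hz]
     constructor <;> linarith)
  | (right; left
     have hY : Y = 1 := by linarith
     subst hY
     have hzz : z = z' := by linarith
     subst hzz
     simp [Follows, arcVertex, arcNext, returnArc_right hz]
     linarith)
  | (right; right
     have hY : Y = 0 := by linarith
     subst hY
     have : returnMap z' = z := by linarith
     simp [Follows, arcNext, arcVertex_zero, this]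
     linarith)

/-- The hypothesis `hinj` excludes strip edges that end at the same point of the branch set. -/
theorem meet_left_right {z z' : ℝ} (hz : z < 1 / 2) (hz' : 1 / 2 < z') (h0 : 0 ≤ z) (h1' : z' ≤ 1)
    (hinj : returnMap z ≠ returnMap z') {k k' : ℕ} (hk : k < 6) (hk' : k' < 6) {P : ℝ × ℝ}
    (hP : P ∈ segment ℝ (arcVertex z k).1 (arcNext z k).1)
    (hP' : P ∈ segment ℝ (arcVertex z' k').1 (arcNext z' k').1) :
    Follows z k z' k' P ∨ Follows z' k' z k P ∨ StripCrossing z k z' k' P := by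
  have hf : returnMap z = 2 * z := if_pos hz
  have hf' : returnMap z' = 2 * z' - 1 := if_neg hz'.not_gt
  obtain ⟨X, Y⟩ := P
  rcases left_edge hz h0 hk hP with ⟨rfl, h⟩ | ⟨rfl, h⟩ | ⟨rfl, h⟩ | ⟨rfl, h⟩ | ⟨rfl, h⟩ | ⟨rfl, h⟩ <;>
  rcases right_edge hz' h1' hk' hP' with
    ⟨rfl, h'⟩ | ⟨rfl, h'⟩ | ⟨rfl, h'⟩ | ⟨rfl, h'⟩ | ⟨rfl, h'⟩ | ⟨rfl, h'⟩ <;>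
  clear hP hP' <;> obtain ⟨e1, e2, e3⟩ := h <;> obtain ⟨e1', e2', e3'⟩ := h' <;> dsimp only at * <;>
  first
  | (exfalso; linarith)
  | (exfalso; nlinarith)
  | (left
     have hY : Y = 0 := by linarith
     subst hY
     have : returnMap z = z' := by linarith
     simp [Follows, arcNext, arcVertex_zero, this]
     linarith)
  | (right; left
     have hY : Y = 0 := by linarith
     subst hY
     have : returnMap z' = z := by linarith
     simp [Follows, arcNext, arcVertex_zero, this]
     linarith)
  | (right; right
     have e : (z' - z) * (2 - Y) = 1 - Y := by linarith
     have hY1 : Y < 1 := by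
       refine lt_of_le_of_ne e3 ?_
       rintro rfl
       linarith
     have hY0 : 0 < Y := by
       refine lt_of_le_of_ne e2 ?_
       rintro rfl
       exact hinj (by linarith)
     refine ⟨rfl, rfl, hY0, hY1, hz, hz', ?_⟩
     rw [hf, hf']
     nlinarith)

/-! ### Edges of cyclic lists -/

theorem edges_map_range {α : Type} (N : ℕ) (v : ℕ → α) :
    edges ((List.range N).map v) = (List.range N).map fun i => (v i, v ((i + 1) % N)) := by
  unfold edges
  apply List.ext_getElem
  · simp
  · intro i h1 h2
    simp [List.getElem_rotate]

theorem edges_map_range_of_periodic {α : Type} {N : ℕ} {v : ℕ → α} (h : v N = v 0) :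
    edges ((List.range N).map v) = (List.range N).map fun i => (v i, v (i + 1)) := by
  rw [edges_map_range]
  refine List.map_congr_left fun i hi => ?_
  rw [List.mem_range] at hi
  rcases Nat.lt_or_ge (i + 1) N with h' | h'
  · rw [Nat.mod_eq_of_lt h']
  · obtain rfl : i + 1 = N := by omega
    rw [Nat.mod_self, h]

theorem edges_shadow (l : List Space) :
    edges (shadow l) = (edges l).map (Prod.map Prod.fst Prod.fst) := by
  simp [edges, shadow, ← List.map_rotate, List.zip_map]

theorem edges_rotate {α : Type} (l : List α) : edges (l.rotate 1) = (edges l).rotate 1 := by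
  unfold edges
  rw [List.zip_eq_zipWith, List.zip_eq_zipWith, List.zipWith_rotate_distrib _ _ _ _ (by simp)]

theorem IsPolygonalKnot.rotate {l : List Space} (h : IsPolygonalKnot l) :
    IsPolygonalKnot (l.rotate 1) := by
  simpa [IsPolygonalKnot, edges_rotate] using h

theorem IsRegular.rotate {s : List (ℝ × ℝ)} (h : IsRegular s) : IsRegular (s.rotate 1) := by
  simpa [IsRegular, edges_rotate] using h

theorem IsDiagram.rotate {D : List Space} (h : IsDiagram D) : IsDiagram (D.rotate 1) := by
  refine ⟨h.1.rotate, ?_⟩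
  rw [shadow, List.map_rotate]
  exact h.2.rotate

theorem KnotEquiv.rotate (l : List Space) (k : ℕ) : KnotEquiv l (l.rotate k) := by
  induction k with
  | zero =>
    rw [List.rotate_zero]
    exact .refl _
  | succ k ih =>
    refine .trans _ _ _ ih (.rel _ _ (Or.inl ?_))
    rw [List.rotate_rotate]

/-! ### The shadow of a Lorenz knot is a regular projection -/

theorem eq_of_fst_eq_of_mem_segment {a c x y : Space} (hac : a.1 ≠ c.1) (hx : x ∈ segment ℝ a c)
    (hy : y ∈ segment ℝ a c) (h : x.1 = y.1) : x = y := by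
  rw [segment_eq_image'] at hx hy
  obtain ⟨u, -, rfl⟩ := hx
  obtain ⟨v, -, rfl⟩ := hy
  have h' : u • (c.1 - a.1) = v • (c.1 - a.1) := add_left_cancel h
  rw [← sub_eq_zero, ← sub_smul, smul_eq_zero, sub_eq_zero, sub_eq_zero] at h'
  rcases h' with h' | h'
  · rw [h']
  · exact absurd h'.symm hac

theorem iterate_periodic {z : ℝ} (hz : z ∈ periodicPts returnMap) (i : ℕ) :
    returnMap^[i] z ∈ periodicPts returnMap :=
  (bijOn_periodicPts returnMap).mapsTo.iterate i hz

theorem mem_branchSet {z : ℝ} (hz : z ∈ periodicPts returnMap) : z ∈ branchSet := by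
  obtain ⟨n, hn, hper⟩ := hz
  obtain ⟨n, rfl⟩ := Nat.exists_eq_succ_of_ne_zero hn.ne'
  have hper' : returnMap (returnMap^[n] z) = z := by
    rw [← iterate_succ_apply' returnMap]
    exact hper
  refine ⟨?_, ?_, ?_⟩
  · by_contra! h
    have : ∀ k, returnMap^[k] z ≤ z := by
      intro k
      induction k with
      | zero => exact le_rfl
      | succ k ih =>
        rw [iterate_succ_apply', returnMap, if_pos (by linarith)]
        linarith
    have h1 := this n
    rw [returnMap, if_pos (by linarith)] at hper'
    linarith
  · by_contra! h
    have : ∀ k, z ≤ returnMap^[k] z := by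
      intro k
      induction k with
      | zero => exact le_rfl
      | succ k ih =>
        rw [iterate_succ_apply', returnMap, if_neg (by linarith)]
        linarith
    have h1 := this n
    rw [returnMap, if_neg (by linarith)] at hper'
    linarith
  · rintro rfl
    have : ∀ k, returnMap^[k] (returnMap (1 / 2)) = 0 := by
      intro k
      induction k with
      | zero => norm_num [returnMap]
      | succ k ih =>
        rw [iterate_succ_apply', ih]
        norm_num [returnMap]
    have h1 := this n
    rw [← iterate_succ_apply, iterate_succ_apply', hper'] at h1
    norm_num at h1

theorem returnMap_inj {z z' : ℝ} (hz : z ∈ periodicPts returnMap)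
    (hz' : z' ∈ periodicPts returnMap) (h : returnMap z = returnMap z') : z = z' :=
  (bijOn_periodicPts returnMap).injOn hz hz' h

/-- Two edges whose shadows meet are equal, consecutive, or strip edges that cross. -/
theorem meet {z z' : ℝ} (hz : z ∈ periodicPts returnMap) (hz' : z' ∈ periodicPts returnMap)
    {k k' : ℕ} (hk : k < 6) (hk' : k' < 6) {P : ℝ × ℝ}
    (hP : P ∈ segment ℝ (arcVertex z k).1 (arcNext z k).1)
    (hP' : P ∈ segment ℝ (arcVertex z' k').1 (arcNext z' k').1) :
    (z = z' ∧ k = k') ∨ Follows z k z' k' P ∨ Follows z' k' z k P ∨ StripCrossing z k z' k' P ∨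
      StripCrossing z' k' z k P := by
  obtain ⟨h0, h1, hm⟩ := mem_branchSet hz
  obtain ⟨h0', h1', hm'⟩ := mem_branchSet hz'
  rcases lt_or_gt_of_ne hm with h | h <;> rcases lt_or_gt_of_ne hm' with h' | h'
  · rcases le_total k k' with hkk | hkk
    · have := meet_left_left h h' h0 h0' hk hk' hkk hP hP'
      tauto
    · have := meet_left_left h' h h0' h0 hk' hk hkk hP' hP
      rw [eq_comm (a := z'), eq_comm (a := k')] at this
      tauto
  · have hne : returnMap z ≠ returnMap z' := fun e => by
      have := returnMap_inj hz hz' e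
      linarith
    have := meet_left_right h h' h0 h1' hne hk hk' hP hP'
    tauto
  · have hne : returnMap z' ≠ returnMap z := fun e => by
      have := returnMap_inj hz' hz e
      linarith
    have := meet_left_right h' h h0' h1 hne hk' hk hP' hP
    tauto
  · rcases le_total k k' with hkk | hkk
    · have := meet_right_right h h' h1 h1' hk hk' hkk hP hP'
      tauto
    · have := meet_right_right h' h h1' h1 hk' hk hkk hP' hP
      rw [eq_comm (a := z'), eq_comm (a := k')] at this
      tauto

theorem arcVertex_fst_ne {z : ℝ} (hz : z ∈ branchSet) {k : ℕ} (hk : k < 6) :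
    (arcVertex z k).1 ≠ (arcNext z k).1 := by
  obtain ⟨h0, h1, hm⟩ := hz
  intro h
  rcases lt_or_gt_of_ne hm with hz | hz
  · interval_cases k <;> simp [arcNext, arcVertex_zero] at h <;>
      simp [arcVertex, returnArc_left hz] at h <;> linarith
  · interval_cases k <;> simp [arcNext, arcVertex_zero] at h <;>
      simp [arcVertex, returnArc_right hz] at h <;> linarith

theorem arcVertex_not_in_strip {z : ℝ} (hz : z ∈ branchSet) {k : ℕ} (hk : k < 6)
    (hpos : 0 < (arcVertex z k).1.2) (hlt : (arcVertex z k).1.2 < 1) : False := by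
  obtain ⟨h0, h1, hm⟩ := hz
  rcases lt_or_gt_of_ne hm with hz | hz
  · interval_cases k <;> simp [arcVertex, returnArc_left hz] at hpos hlt <;> linarith
  · interval_cases k <;> simp [arcVertex, returnArc_right hz] at hpos hlt <;> linarith

/-- A vertex on an edge, in the shadow, is an end point of this edge. -/
theorem vertex_on_edge {z z' : ℝ} (hz : z ∈ periodicPts returnMap)
    (hz' : z' ∈ periodicPts returnMap) {k k' : ℕ} (hk : k < 6) (hk' : k' < 6)
    (h : (arcVertex z' k').1 ∈ segment ℝ (arcVertex z k).1 (arcNext z k).1) :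
    (z = z' ∧ k = k') ∨ arcVertex z' k' = arcNext z k := by
  rcases meet hz hz' hk hk' h (left_mem_segment ℝ _ _) with h | h | h | h | h
  · exact Or.inl h
  · exact Or.inr h.2.symm
  · exact absurd h.1 (arcVertex_fst_ne (mem_branchSet hz') hk')
  · exact (arcVertex_not_in_strip (mem_branchSet hz') hk' h.pos h.lt_one).elim
  · exact (arcVertex_not_in_strip (mem_branchSet hz') hk' h.pos h.lt_one).elim

theorem arcVertex_fst_inj {z z' : ℝ} (hz : z ∈ periodicPts returnMap)
    (hz' : z' ∈ periodicPts returnMap) {k k' : ℕ} (hk : k < 6) (hk' : k' < 6)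
    (h : (arcVertex z k).1 = (arcVertex z' k').1) : z = z' ∧ k = k' := by
  rcases vertex_on_edge hz hz' hk hk' (h ▸ left_mem_segment ℝ _ _) with h' | h'
  · exact h'
  · rw [h'] at h
    exact absurd h (arcVertex_fst_ne (mem_branchSet hz) hk)

/-- No third edge passes, in the shadow, through the common vertex of two consecutive edges. -/
theorem no_third_edge {z₁ z₂ z₃ : ℝ} (h₁ : z₁ ∈ periodicPts returnMap)
    (h₂ : z₂ ∈ periodicPts returnMap) (h₃ : z₃ ∈ periodicPts returnMap) {k₁ k₂ k₃ : ℕ}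
    (hk₁ : k₁ < 6) (hk₂ : k₂ < 6) (hk₃ : k₃ < 6) {P : ℝ × ℝ} (h : Follows z₁ k₁ z₂ k₂ P)
    (hP : P ∈ segment ℝ (arcVertex z₃ k₃).1 (arcNext z₃ k₃).1)
    (h13 : ¬ (z₁ = z₃ ∧ k₁ = k₃)) (h23 : ¬ (z₂ = z₃ ∧ k₂ = k₃)) : False := by
  obtain ⟨rfl, h⟩ := h
  have hs := arcVertex_not_in_strip (mem_branchSet h₂) hk₂
  rw [← h] at hs
  rcases meet h₁ h₃ hk₁ hk₃ (right_mem_segment ℝ _ _) hP with h' | h' | h' | h' | h'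
  · exact h13 h'
  · exact h23 (arcVertex_fst_inj h₂ h₃ hk₂ hk₃ (by rw [← h, h'.2]))
  · exact arcVertex_fst_ne (mem_branchSet h₁) hk₁ (by rw [h'.1, h'.2])
  · exact hs h'.pos h'.lt_one
  · exact hs h'.pos h'.lt_one

/-- At a crossing of the shadow the strand on top is the one that comes from the left. -/
theorem stripCrossing_of_over {z z' : ℝ} (hz : z ∈ periodicPts returnMap)
    (hz' : z' ∈ periodicPts returnMap) {k k' : ℕ} (hk : k < 6) (hk' : k' < 6) {p q : Space}
    (hp : p ∈ segment ℝ (arcVertex z k) (arcNext z k))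
    (hq : q ∈ segment ℝ (arcVertex z' k') (arcNext z' k')) (hpq : p.1 = q.1) (hlt : q.2 < p.2) :
    StripCrossing z k z' k' p.1 := by
  have hne := arcVertex_fst_ne (mem_branchSet hz) hk
  have hne' := arcVertex_fst_ne (mem_branchSet hz') hk'
  rcases meet hz hz' hk hk' (fst_mem_segment hp) (hpq ▸ fst_mem_segment hq) with
    h | h | h | h | h
  · obtain ⟨rfl, rfl⟩ := h
    rw [eq_of_fst_eq_of_mem_segment hne hp hq hpq] at hlt
    exact (lt_irrefl _ hlt).elim
  · have e1 := eq_of_fst_eq_of_mem_segment hne hp (right_mem_segment ℝ _ _) h.1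
    have e2 := eq_of_fst_eq_of_mem_segment hne' hq (left_mem_segment ℝ _ _)
      (by rw [← hpq, h.1, h.2])
    rw [e1, e2, h.2] at hlt
    exact (lt_irrefl _ hlt).elim
  · have e1 := eq_of_fst_eq_of_mem_segment hne' hq (right_mem_segment ℝ _ _) (hpq ▸ h.1)
    have e2 := eq_of_fst_eq_of_mem_segment hne hp (left_mem_segment ℝ _ _)
      (by rw [h.1, h.2])
    rw [e1, e2, h.2] at hlt
    exact (lt_irrefl _ hlt).elim
  · exact h
  · obtain rfl := h.left_strip
    obtain rfl := h.right_strip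
    have e1 := right_strip_height h.right hp
    have e2 := left_strip_height h.left hq
    rw [← hpq] at e2
    have := h.pos
    linarith

/-! ### A Lorenz knot as a cyclic sequence of vertices -/

/-- The vertices of the polygonal orbit of `x`, numbered along the flow. -/
noncomputable def orbitVertex (x : ℝ) (m : ℕ) : Space := arcVertex (returnMap^[m / 6] x) (m % 6)

theorem orbitVertex_succ (x : ℝ) (m : ℕ) :
    orbitVertex x (m + 1) = arcNext (returnMap^[m / 6] x) (m % 6) := by
  unfold orbitVertex arcNext
  split_ifs with h
  · rw [← iterate_succ_apply' returnMap]
    congr 2 <;> omega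
  · congr 2 <;> omega

theorem orbitVertex_add (x : ℝ) (m i : ℕ) :
    orbitVertex x (m + 6 * i) = orbitVertex (returnMap^[i] x) m := by
  have h1 : (m + 6 * i) / 6 = m / 6 + i := by omega
  have h2 : (m + 6 * i) % 6 = m % 6 := by omega
  rw [orbitVertex, orbitVertex, h1, h2, iterate_add_apply]

theorem orbitVertex_add_period (x : ℝ) (m : ℕ) :
    orbitVertex x (m + 6 * minimalPeriod returnMap x) = orbitVertex x m := by
  rw [orbitVertex_add, iterate_minimalPeriod]

theorem map_arcVertex (z : ℝ) : (List.range 6).map (arcVertex z) = returnArc z := by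
  unfold arcVertex returnArc
  split_ifs <;> rfl

theorem lorenzKnot_eq (x : ℝ) :
    lorenzKnot x = (List.range (6 * minimalPeriod returnMap x)).map (orbitVertex x) := by
  unfold lorenzKnot
  generalize minimalPeriod returnMap x = n
  induction n with
  | zero => rfl
  | succ n ih =>
    rw [List.range_succ, List.flatMap_append, ih, Nat.mul_succ, List.range_add, List.map_append,
      List.map_map]
    congr 1
    rw [List.flatMap_singleton, ← map_arcVertex]
    refine List.map_congr_left fun k hk => ?_
    rw [List.mem_range] at hk
    simp only [orbitVertex, comp_apply]
    congr 2 <;> [(congr 1; omega); omega]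

theorem rotate_map_range {α : Type} {N : ℕ} {v : ℕ → α} (h : ∀ i, v (i + N) = v i) (k : ℕ) :
    ((List.range N).map v).rotate k = (List.range N).map fun i => v (i + k) := by
  have hmod : ∀ i, v (i % N) = v i := by
    intro i
    conv_rhs => rw [← Nat.mod_add_div i N]
    generalize i / N = q
    induction q with
    | zero => simp
    | succ q ih => rw [Nat.mul_succ, ← add_assoc, h, ← ih]
  apply List.ext_getElem
  · simp
  · intro i h1 h2
    simp [List.getElem_rotate, hmod]

theorem orbitVertex_fst_inj {x : ℝ} (hx : x ∈ periodicPts returnMap) {i j : ℕ}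
    (hi : i < 6 * minimalPeriod returnMap x) (hj : j < 6 * minimalPeriod returnMap x)
    (h : (orbitVertex x i).1 = (orbitVertex x j).1) : i = j := by
  obtain ⟨h1, h2⟩ := arcVertex_fst_inj (iterate_periodic hx _) (iterate_periodic hx _)
    (Nat.mod_lt _ (by norm_num)) (Nat.mod_lt _ (by norm_num)) h
  have := iterate_injOn_Iio_minimalPeriod (f := returnMap) (x := x)
    (Set.mem_Iio.2 (by omega)) (Set.mem_Iio.2 (by omega)) h1
  omega

theorem edges_lorenzKnot (x : ℝ) : edges (lorenzKnot x) =
    (List.range (6 * minimalPeriod returnMap x)).map fun m =>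
      (arcVertex (returnMap^[m / 6] x) (m % 6), arcNext (returnMap^[m / 6] x) (m % 6)) := by
  rw [lorenzKnot_eq, edges_map_range_of_periodic (by simpa using orbitVertex_add_period x 0)]
  simp only [orbitVertex_succ]
  rfl

theorem exists_of_mem_edges {x : ℝ} (hx : x ∈ periodicPts returnMap) {e : Space × Space}
    (he : e ∈ edges (lorenzKnot x)) : ∃ z ∈ periodicPts returnMap, ∃ k < 6,
      e = (arcVertex z k, arcNext z k) := by
  rw [edges_lorenzKnot, List.mem_map] at he
  obtain ⟨m, -, rfl⟩ := he
  exact ⟨_, iterate_periodic hx _, _, Nat.mod_lt _ (by norm_num), rfl⟩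

theorem isDiagram_lorenzKnot {x : ℝ} (hx : x ∈ periodicPts returnMap) :
    IsDiagram (lorenzKnot x) := by
  have hnodup : (shadow (lorenzKnot x)).Nodup := by
    rw [shadow, lorenzKnot_eq, List.map_map]
    refine List.Nodup.map_on ?_ List.nodup_range
    intro i hi j hj h
    exact orbitVertex_fst_inj hx (List.mem_range.1 hi) (List.mem_range.1 hj) h
  refine ⟨⟨?_, hnodup.of_map, ?_⟩, hnodup, ?_, ?_⟩
  · have := minimalPeriod_pos_of_mem_periodicPts hx
    rw [lorenzKnot_eq]
    simp
    omega
  · intro e he e' he' hne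
    obtain ⟨z, hz, k, hk, rfl⟩ := exists_of_mem_edges hx he
    obtain ⟨z', hz', k', hk', rfl⟩ := exists_of_mem_edges hx he'
    rintro p ⟨hp, hp'⟩
    have hne1 := arcVertex_fst_ne (mem_branchSet hz) hk
    have hne2 := arcVertex_fst_ne (mem_branchSet hz') hk'
    rcases meet hz hz' hk hk' (fst_mem_segment hp) (fst_mem_segment hp') with h | h | h | h | h
    · obtain ⟨rfl, rfl⟩ := h
      exact absurd rfl hne
    · have e1 := eq_of_fst_eq_of_mem_segment hne1 hp (right_mem_segment ℝ _ _) h.1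
      exact ⟨Or.inr e1, Or.inl (e1.trans h.2)⟩
    · have e1 := eq_of_fst_eq_of_mem_segment hne2 hp' (right_mem_segment ℝ _ _) h.1
      exact ⟨Or.inl (e1.trans h.2), Or.inr e1⟩
    · obtain rfl := h.left_strip
      obtain rfl := h.right_strip
      linarith [h.pos, left_strip_height h.left hp, right_strip_height h.right hp']
    · obtain rfl := h.left_strip
      obtain rfl := h.right_strip
      linarith [h.pos, left_strip_height h.left hp', right_strip_height h.right hp]
  · intro e he P hP hPe
    rw [edges_shadow, List.mem_map] at he
    obtain ⟨e, he, rfl⟩ := he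
    obtain ⟨z, hz, k, hk, rfl⟩ := exists_of_mem_edges hx he
    rw [shadow, lorenzKnot_eq, List.map_map, List.mem_map] at hP
    obtain ⟨m, -, rfl⟩ := hP
    rcases vertex_on_edge hz (iterate_periodic hx _) hk (Nat.mod_lt _ (by norm_num)) hPe with h | h
    · obtain ⟨rfl, rfl⟩ := h
      exact Or.inl rfl
    · exact Or.inr (congrArg Prod.fst h)
  · intro e₁ he₁ e₂ he₂ e₃ he₃ h12 h13 h23
    rw [edges_shadow, List.mem_map] at he₁ he₂ he₃
    obtain ⟨e₁, he₁, rfl⟩ := he₁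
    obtain ⟨e₂, he₂, rfl⟩ := he₂
    obtain ⟨e₃, he₃, rfl⟩ := he₃
    obtain ⟨z₁, hz₁, k₁, hk₁, rfl⟩ := exists_of_mem_edges hx he₁
    obtain ⟨z₂, hz₂, k₂, hk₂, rfl⟩ := exists_of_mem_edges hx he₂
    obtain ⟨z₃, hz₃, k₃, hk₃, rfl⟩ := exists_of_mem_edges hx he₃
    have n12 : ¬ (z₁ = z₂ ∧ k₁ = k₂) := by rintro ⟨rfl, rfl⟩; exact h12 rfl
    have n13 : ¬ (z₁ = z₃ ∧ k₁ = k₃) := by rintro ⟨rfl, rfl⟩; exact h13 rfl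
    have n23 : ¬ (z₂ = z₃ ∧ k₂ = k₃) := by rintro ⟨rfl, rfl⟩; exact h23 rfl
    have n21 : ¬ (z₂ = z₁ ∧ k₂ = k₁) := by rintro ⟨rfl, rfl⟩; exact h12 rfl
    have n31 : ¬ (z₃ = z₁ ∧ k₃ = k₁) := by rintro ⟨rfl, rfl⟩; exact h13 rfl
    have n32 : ¬ (z₃ = z₂ ∧ k₃ = k₂) := by rintro ⟨rfl, rfl⟩; exact h23 rfl
    rw [Set.eq_empty_iff_forall_notMem]
    rintro P ⟨⟨p1, p2⟩, p3⟩
    -- At a crossing of two edges one comes from the left and the other from the right, so that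
    -- there cannot be three edges any two of which cross.
    rcases meet hz₁ hz₂ hk₁ hk₂ p1 p2 with h | h | h | h | h
    · exact n12 h
    · exact no_third_edge hz₁ hz₂ hz₃ hk₁ hk₂ hk₃ h p3 n13 n23
    · exact no_third_edge hz₂ hz₁ hz₃ hk₂ hk₁ hk₃ h p3 n23 n13
    all_goals
      rcases meet hz₁ hz₃ hk₁ hk₃ p1 p3 with h' | h' | h' | h' | h'
      · exact n13 h'
      · exact no_third_edge hz₁ hz₃ hz₂ hk₁ hk₃ hk₂ h' p2 n12 n32
      · exact no_third_edge hz₃ hz₁ hz₂ hk₃ hk₁ hk₂ h' p2 n32 n12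
      all_goals
        rcases meet hz₂ hz₃ hk₂ hk₃ p2 p3 with h'' | h'' | h'' | h'' | h''
        · exact n23 h''
        · exact no_third_edge hz₂ hz₃ hz₁ hk₂ hk₃ hk₁ h'' p1 n21 n31
        · exact no_third_edge hz₃ hz₂ hz₁ hk₃ hk₂ hk₁ h'' p1 n31 n21
        all_goals linarith [h.left, h.right, h'.left, h'.right, h''.left, h''.right]

/-! ### The number of crossings -/

theorem mem_orbitPoints {x : ℝ} (hx : x ∈ periodicPts returnMap) {z : ℝ} :
    z ∈ orbitPoints x ↔ ∃ i, returnMap^[i] x = z := by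
  simp only [orbitPoints, Finset.mem_image, Finset.mem_range]
  constructor
  · rintro ⟨i, -, h⟩
    exact ⟨i, h⟩
  · rintro ⟨i, rfl⟩
    exact ⟨i % minimalPeriod returnMap x, Nat.mod_lt _ (minimalPeriod_pos_of_mem_periodicPts hx),
      iterate_mod_minimalPeriod_eq⟩

theorem orbitPoints_iterate {x : ℝ} (hx : x ∈ periodicPts returnMap) (i : ℕ) :
    orbitPoints (returnMap^[i] x) = orbitPoints x := by
  ext z
  rw [mem_orbitPoints hx, mem_orbitPoints (iterate_periodic hx i)]
  constructor
  · rintro ⟨j, rfl⟩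
    exact ⟨j + i, iterate_add_apply _ _ _ _⟩
  · rintro ⟨j, rfl⟩
    have hn := minimalPeriod_pos_of_mem_periodicPts hx
    refine ⟨j + minimalPeriod returnMap x * i - i, ?_⟩
    have : i ≤ minimalPeriod returnMap x * i := Nat.le_mul_of_pos_left i hn
    rw [← iterate_add_apply, Nat.sub_add_cancel (by omega), iterate_add_apply]
    congr 1
    exact ((isPeriodicPt_minimalPeriod returnMap x).mul_const i)

theorem periodic_of_mem_orbitPoints {x : ℝ} (hx : x ∈ periodicPts returnMap) {z : ℝ}
    (hz : z ∈ orbitPoints x) : z ∈ periodicPts returnMap := by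
  obtain ⟨i, rfl⟩ := (mem_orbitPoints hx).1 hz
  exact iterate_periodic hx i

theorem injOn_orbitPoints {x : ℝ} (hx : x ∈ periodicPts returnMap) :
    Set.InjOn returnMap (orbitPoints x) := fun _ hz _ hz' h =>
  returnMap_inj (periodic_of_mem_orbitPoints hx hz) (periodic_of_mem_orbitPoints hx hz') h

theorem image_orbitPoints {x : ℝ} (hx : x ∈ periodicPts returnMap) :
    (orbitPoints x).image returnMap = orbitPoints x := by
  refine Finset.eq_of_subset_of_card_le ?_ ?_
  · intro z hz
    obtain ⟨w, hw, rfl⟩ := Finset.mem_image.1 hz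
    obtain ⟨i, rfl⟩ := (mem_orbitPoints hx).1 hw
    exact (mem_orbitPoints hx).2 ⟨i + 1, iterate_succ_apply' _ _ _⟩
  · rw [Finset.card_image_of_injOn (injOn_orbitPoints hx)]

/-- The number of points of the orbit of `x` to the left of `z`. -/
noncomputable def rank (x z : ℝ) : ℤ := ((orbitPoints x).filter fun w => w < z).card

theorem sum_orbitPoints {x : ℝ} (hx : x ∈ periodicPts returnMap) (φ : ℝ → ℤ) :
    ∑ z ∈ orbitPoints x, φ z = ∑ z ∈ leftPoints x, φ z + ∑ z ∈ rightPoints x, φ z := by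
  rw [leftPoints, rightPoints, ← Finset.sum_filter_add_sum_filter_not _ fun z => z < 1 / 2]
  congr 1
  refine Finset.sum_congr (Finset.filter_congr fun z hz => ?_) fun _ _ => rfl
  have := (mem_branchSet (periodic_of_mem_orbitPoints hx hz)).2.2
  rw [not_lt]
  exact ⟨fun h => lt_of_le_of_ne h this.symm, le_of_lt⟩

theorem returnMap_lt_iff_of_left {z z' : ℝ} (hz : z < 1 / 2) (hz' : z' < 1 / 2) :
    returnMap z < returnMap z' ↔ z < z' := by
  rw [returnMap, returnMap, if_pos hz, if_pos hz']
  constructor <;> intro h <;> linarith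

theorem returnMap_lt_iff_of_right {z z' : ℝ} (hz : 1 / 2 < z) (hz' : 1 / 2 < z') :
    returnMap z < returnMap z' ↔ z < z' := by
  rw [returnMap, returnMap, if_neg hz.not_gt, if_neg hz'.not_gt]
  constructor <;> intro h <;> linarith

/-- The number of strands from the right which a strand from the left crosses is the number of
places by which it moves to the right. -/
theorem sum_crossings_left {x : ℝ} (hx : x ∈ periodicPts returnMap) {p : ℝ}
    (hp : p ∈ leftPoints x) :
    (∑ q ∈ rightPoints x, if returnMap q < returnMap p then (1 : ℤ) else 0) =
      rank x (returnMap p) - rank x p := by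
  have h1 : rank x (returnMap p) =
      ∑ z ∈ orbitPoints x, if returnMap z < returnMap p then (1 : ℤ) else 0 := by
    rw [rank, Finset.card_filter]
    conv_lhs => rw [← image_orbitPoints hx, Finset.sum_image (injOn_orbitPoints hx)]
    push_cast
    rfl
  have h2 : rank x p = ∑ z ∈ leftPoints x, if returnMap z < returnMap p then (1 : ℤ) else 0 := by
    rw [rank, Finset.card_filter]
    push_cast
    rw [sum_orbitPoints hx]
    have : ∑ z ∈ rightPoints x, (if z < p then (1 : ℤ) else 0) = 0 := by
      refine Finset.sum_eq_zero fun z hz => if_neg ?_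
      have a1 := (Finset.mem_filter.1 hz).2
      have a2 := (Finset.mem_filter.1 hp).2
      linarith
    rw [this, add_zero]
    refine Finset.sum_congr rfl fun z hz => ?_
    simp only [returnMap_lt_iff_of_left (Finset.mem_filter.1 hz).2 (Finset.mem_filter.1 hp).2]
  rw [h1, h2, sum_orbitPoints hx]
  ring

theorem sum_inter_image {x : ℝ} (hx : x ∈ periodicPts returnMap) {U : Finset ℝ}
    (hU : U ⊆ orbitPoints x) (φ : ℝ → ℤ) :
    ∑ z ∈ U, φ z = ∑ z ∈ U ∩ (leftPoints x).image returnMap, φ z +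
      ∑ z ∈ U ∩ (rightPoints x).image returnMap, φ z := by
  have e : ∀ V : Finset ℝ, V ⊆ orbitPoints x →
      ∑ z ∈ U ∩ V.image returnMap, φ z = ∑ z ∈ V, if returnMap z ∈ U then φ (returnMap z) else 0 := by
    intro V hV
    rw [Finset.inter_comm, ← Finset.filter_mem_eq_inter, Finset.sum_filter,
      Finset.sum_image ((injOn_orbitPoints hx).mono hV)]
  rw [e (leftPoints x) (Finset.filter_subset _ _),
    e (rightPoints x) (Finset.filter_subset _ _), ← sum_orbitPoints hx,
    ← e _ subset_rfl, image_orbitPoints hx, Finset.inter_eq_left.2 hU]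

/-- The number of crossings of the shadow is the total rank of the points on the right reached
from the left, minus that of the points on the left reached from the right. -/
theorem sum_crossings {x : ℝ} (hx : x ∈ periodicPts returnMap) :
    (∑ p ∈ leftPoints x, ∑ q ∈ rightPoints x,
      if returnMap q < returnMap p then (1 : ℤ) else 0) =
      ∑ z ∈ rightPoints x ∩ (leftPoints x).image returnMap, rank x z -
        ∑ z ∈ leftPoints x ∩ (rightPoints x).image returnMap, rank x z := by
  rw [Finset.sum_congr rfl fun p hp => sum_crossings_left hx hp, Finset.sum_sub_distrib]
  have hL : leftPoints x ⊆ orbitPoints x := Finset.filter_subset _ _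
  have h1 := sum_inter_image hx hL (rank x)
  have h2 : ∑ p ∈ leftPoints x, rank x (returnMap p) =
      ∑ z ∈ leftPoints x ∩ (leftPoints x).image returnMap, rank x z +
        ∑ z ∈ rightPoints x ∩ (leftPoints x).image returnMap, rank x z := by
    rw [← Finset.sum_image (f := rank x) ((injOn_orbitPoints hx).mono hL)]
    have e : ∀ V : Finset ℝ, ∑ z ∈ V ∩ (leftPoints x).image returnMap, rank x z =
        ∑ z ∈ V, if z ∈ (leftPoints x).image returnMap then rank x z else 0 := by
      intro V
      rw [← Finset.filter_mem_eq_inter, Finset.sum_filter]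
    rw [e, e, ← sum_orbitPoints hx, ← e, Finset.inter_eq_right.2]
    exact (Finset.image_subset_image hL).trans (image_orbitPoints hx).le
  rw [h1, h2]
  ring

theorem card_right_reached {x : ℝ} (hx : x ∈ periodicPts returnMap) :
    (rightPoints x ∩ (leftPoints x).image returnMap).card = tripNumber x := by
  rw [tripNumber, Finset.inter_comm, ← Finset.filter_mem_eq_inter, Finset.filter_image,
    Finset.card_image_of_injOn]
  exact (injOn_orbitPoints hx).mono fun z hz =>
    (Finset.mem_filter.1 (Finset.mem_filter.1 hz).1).1

theorem card_left_reached {x : ℝ} (hx : x ∈ periodicPts returnMap) :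
    (leftPoints x ∩ (rightPoints x).image returnMap).card = tripNumber x := by
  rw [← card_right_reached hx]
  have hL : leftPoints x ⊆ orbitPoints x := Finset.filter_subset _ _
  have h1 := sum_inter_image hx hL fun _ => 1
  have hcard := Finset.card_image_of_injOn ((injOn_orbitPoints hx).mono hL)
  have h2 : ((leftPoints x).image returnMap).card =
      (leftPoints x ∩ (leftPoints x).image returnMap).card +
        (rightPoints x ∩ (leftPoints x).image returnMap).card := by
    have e : ∀ V : Finset ℝ, (((V ∩ (leftPoints x).image returnMap).card : ℕ) : ℤ) =
        ∑ z ∈ V, if z ∈ (leftPoints x).image returnMap then 1 else 0 := by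
      intro V
      rw [← Finset.filter_mem_eq_inter, Finset.card_filter]
      push_cast
      rfl
    zify
    rw [e, e, ← sum_orbitPoints hx, ← e, Finset.inter_eq_right.2]
    exact (Finset.image_subset_image hL).trans (image_orbitPoints hx).le
  simp only [Finset.sum_const, nsmul_eq_mul, mul_one] at h1
  omega

theorem card_orbitPoints {x : ℝ} (hx : x ∈ periodicPts returnMap) :
    ((orbitPoints x).card : ℤ) = numLeft x + numRight x := by
  simpa [numLeft, numRight] using sum_orbitPoints hx fun _ => 1

theorem injOn_card_filter {r : ℝ → ℝ → Prop} [DecidableRel r] (hrefl : ∀ a, r a a)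
    (htrans : ∀ a b c, r a b → r b c → r a c) (hanti : ∀ a b, r a b → r b a → a = b)
    (htotal : ∀ a b, r a b ∨ r b a) (s : Finset ℝ) :
    Set.InjOn (fun z => (s.filter fun w => r w z).card) s := by
  have aux : ∀ z z' : ℝ, z' ∈ s → r z z' →
      (s.filter fun w => r w z).card = (s.filter fun w => r w z').card → z = z' := by
    intro z z' hz' hzz h
    have hsub : (s.filter fun w => r w z) ⊆ s.filter fun w => r w z' :=
      Finset.monotone_filter_right s fun w _ hw => htrans _ _ _ hw hzz
    have hmem : z' ∈ s.filter fun w => r w z := by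
      rw [Finset.eq_of_subset_of_card_le hsub h.ge]
      exact Finset.mem_filter.2 ⟨hz', hrefl z'⟩
    exact hanti _ _ hzz (Finset.mem_filter.1 hmem).2
  intro z hz z' hz' h
  rcases htotal z z' with hzz | hzz
  · exact aux z z' hz' hzz h
  · exact (aux z' z hz hzz h.symm).symm

theorem sum_muIndices (x : ℝ) :
    ∑ i ∈ muIndices x, (i : ℤ) =
      ∑ z ∈ leftPoints x ∩ (rightPoints x).image returnMap, (rank x z + 1) := by
  have key : ∀ z ∈ leftPoints x, (((leftPoints x).filter fun p' => p' ≤ z).card : ℤ) =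
      rank x z + 1 := by
    intro z hz
    have hz' := Finset.mem_filter.1 hz
    have : (leftPoints x).filter (fun p' => p' ≤ z) =
        insert z ((orbitPoints x).filter fun w => w < z) := by
      ext w
      simp only [leftPoints, Finset.mem_filter, Finset.mem_insert]
      constructor
      · rintro ⟨⟨h1, h2⟩, h3⟩
        rcases h3.eq_or_lt with h | h
        · exact Or.inl h
        · exact Or.inr ⟨h1, h⟩
      · rintro (rfl | ⟨h1, h2⟩)
        · exact ⟨hz', le_rfl⟩
        · exact ⟨⟨h1, h2.trans hz'.2⟩, h2.le⟩
    rw [this, Finset.card_insert_of_notMem (by simp), rank]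
    push_cast
    rfl
  rw [muIndices, Finset.sum_image]
  · exact Finset.sum_congr rfl fun z hz => key z (Finset.mem_inter.1 hz).1
  · exact (injOn_card_filter (r := fun a b => a ≤ b) le_refl (fun _ _ _ => le_trans)
      (fun _ _ => le_antisymm) le_total _).mono (Finset.coe_subset.2 Finset.inter_subset_left)

theorem sum_nuIndices {x : ℝ} (hx : x ∈ periodicPts returnMap) :
    ∑ i ∈ nuIndices x, (i : ℤ) =
      ∑ z ∈ rightPoints x ∩ (leftPoints x).image returnMap,
        ((numLeft x + numRight x : ℤ) - rank x z) := by
  have key : ∀ z ∈ rightPoints x, (((rightPoints x).filter fun q => z ≤ q).card : ℤ) =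
      (numLeft x + numRight x : ℤ) - rank x z := by
    intro z hz
    have hz' := Finset.mem_filter.1 hz
    have : (rightPoints x).filter (fun q => z ≤ q) = (orbitPoints x).filter fun w => ¬ w < z := by
      ext w
      simp only [rightPoints, Finset.mem_filter, not_lt]
      exact ⟨fun h => ⟨h.1.1, h.2⟩, fun h => ⟨⟨h.1, hz'.2.trans_le h.2⟩, h.2⟩⟩
    rw [this, ← card_orbitPoints hx, rank,
      ← Finset.card_filter_add_card_filter_not (s := orbitPoints x) fun w => w < z]
    push_cast
    ring
  rw [nuIndices, Finset.sum_image]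
  · exact Finset.sum_congr rfl fun z hz => key z (Finset.mem_inter.1 hz).1
  · exact (injOn_card_filter (r := fun a b => b ≤ a) le_refl (fun _ _ _ h h' => h'.trans h)
      (fun _ _ h h' => le_antisymm h' h) (fun a b => le_total b a) _).mono
      (Finset.coe_subset.2 Finset.inter_subset_left)

/-- The number of crossings of the Lorenz braid in terms of the indices `μ` and `ν`. -/
theorem crossings_eq {x : ℝ} (hx : x ∈ periodicPts returnMap) :
    (∑ p ∈ leftPoints x, ∑ q ∈ rightPoints x,
      if returnMap q < returnMap p then (1 : ℤ) else 0) =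
      (tripNumber x : ℤ) * (numLeft x + numRight x + 1)
        - ∑ i ∈ muIndices x, (i : ℤ) - ∑ i ∈ nuIndices x, (i : ℤ) := by
  rw [sum_crossings hx, sum_muIndices x, sum_nuIndices hx, Finset.sum_add_distrib,
    Finset.sum_sub_distrib, Finset.sum_const, Finset.sum_const, card_right_reached hx,
    card_left_reached hx]
  simp only [nsmul_eq_mul]
  ring

/-! ### The crossings that have to be changed -/

theorem sum_range_telescope (g : ℕ → ℕ → ℤ) (n : ℕ) :
    ∑ j ∈ Finset.range (n + 1), ∑ i ∈ Finset.range j, (g i j - g (i + 1) (j + 1)) =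
      ∑ j ∈ Finset.range n, (g 0 (j + 1) - g (j + 1) (n + 1)) := by
  induction n with
  | zero => simp
  | succ n ih =>
    rw [Finset.sum_range_succ, ih, Finset.sum_sub_distrib, Finset.sum_sub_distrib,
      Finset.sum_sub_distrib, Finset.sum_range_succ' (fun i => g i (n + 1)),
      Finset.sum_range_succ (fun j => g 0 (j + 1))]
    ring

theorem sum_range_sum_range (h : ℕ → ℕ → ℤ) (hdiag : ∀ i, h i i = 0) (n : ℕ) :
    ∑ i ∈ Finset.range n, ∑ j ∈ Finset.range n, h i j =
      ∑ j ∈ Finset.range n, ∑ i ∈ Finset.range j, (h i j + h j i) := by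
  induction n with
  | zero => simp
  | succ n ih =>
    simp only [Finset.sum_range_succ, Finset.sum_add_distrib, hdiag] at ih ⊢
    linarith

/-- The strand from the left point `z` crosses the strand from the right point `z'`. -/
def Crosses (z z' : ℝ) : Prop := z < 1 / 2 ∧ 1 / 2 < z' ∧ returnMap z' < returnMap z

open Classical in
/-- The indicator of `Crosses`. -/
noncomputable def crossing (z z' : ℝ) : ℤ := if Crosses z z' then 1 else 0

open Classical in
/-- The sign with which the order of two points is changed by the return map. -/
theorem crossing_sub_crossing {z z' : ℝ} (hz : z ∈ branchSet) (hz' : z' ∈ branchSet)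
    (hne : returnMap z ≠ returnMap z') :
    (if z < z' then (1 : ℤ) else 0) - (if returnMap z < returnMap z' then 1 else 0) =
      crossing z z' - crossing z' z := by
  obtain ⟨-, -, hm⟩ := hz
  obtain ⟨-, -, hm'⟩ := hz'
  unfold crossing Crosses
  rcases lt_or_gt_of_ne hm with h | h <;> rcases lt_or_gt_of_ne hm' with h' | h'
  · simp only [returnMap_lt_iff_of_left h h', h.not_gt, h'.not_gt, false_and, and_false, if_false,
      sub_self]
  · grind
  · grind
  · simp only [returnMap_lt_iff_of_right h h', h.not_gt, h'.not_gt, false_and, if_false,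
      sub_self]

open Classical in
/-- The pairs of times `(i, j)`, `i < j`, such that the strand that leaves at the time `i` passes
under the strand that leaves at the time `j`. -/
noncomputable def badPairs (x : ℝ) : Finset (ℕ × ℕ) :=
  (Finset.range (minimalPeriod returnMap x) ×ˢ Finset.range (minimalPeriod returnMap x)).filter
    fun ij => ij.1 < ij.2 ∧ Crosses (returnMap^[ij.2] x) (returnMap^[ij.1] x)

theorem card_badPairs_eq_sum (x : ℝ) : ((badPairs x).card : ℤ) =
    ∑ j ∈ Finset.range (minimalPeriod returnMap x), ∑ i ∈ Finset.range j,
      crossing (returnMap^[j] x) (returnMap^[i] x) := by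
  classical
  rw [badPairs, Finset.card_filter, Finset.sum_product_right]
  push_cast
  refine Finset.sum_congr rfl fun j hj => ?_
  rw [Finset.mem_range] at hj
  rw [← Finset.sum_subset (Finset.range_subset_range.2 hj.le)]
  · refine Finset.sum_congr rfl fun i hi => ?_
    simp [crossing, Finset.mem_range.1 hi]
  · intro i _ hi
    rw [Finset.mem_range] at hi
    exact if_neg fun h => hi h.1

/-- If the orbit of `n` points is followed from its leftmost point, then the crossings at which the
strand visited first comes from the left outnumber those at which it comes from the right by
`n - 1`, because the difference of the two numbers telescopes. -/
theorem two_mul_card_badPairs {x : ℝ} (hx : x ∈ periodicPts returnMap)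
    (hmin : ∀ i, x ≤ returnMap^[i] x) :
    2 * ((badPairs x).card : ℤ) + (minimalPeriod returnMap x - 1) =
      ∑ p ∈ leftPoints x, ∑ q ∈ rightPoints x,
        if returnMap q < returnMap p then (1 : ℤ) else 0 := by
  classical
  set n := minimalPeriod returnMap x with hn
  have hn0 : 0 < n := minimalPeriod_pos_of_mem_periodicPts hx
  have hinj := iterate_injOn_Iio_minimalPeriod (f := returnMap) (x := x)
  have hne : ∀ i j, i < j → j < n → returnMap^[i] x ≠ returnMap^[j] x := fun i j hij hj h =>
    hij.ne (hinj (Set.mem_Iio.2 (hij.trans hj)) (Set.mem_Iio.2 hj) h)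
  have hdiff : ∑ j ∈ Finset.range n, ∑ i ∈ Finset.range j,
      (crossing (returnMap^[i] x) (returnMap^[j] x) -
        crossing (returnMap^[j] x) (returnMap^[i] x)) = n - 1 := by
    obtain ⟨m, hm⟩ := Nat.exists_eq_succ_of_ne_zero hn0.ne'
    have ht := sum_range_telescope
      (fun i j => if returnMap^[i] x < returnMap^[j] x then 1 else 0) m
    have hR : ∑ j ∈ Finset.range m, ((if returnMap^[0] x < returnMap^[j + 1] x then (1 : ℤ) else 0) -
        if returnMap^[j + 1] x < returnMap^[m + 1] x then 1 else 0) = m := by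
      rw [Finset.sum_congr rfl (g := fun _ => 1)]
      · simp
      · intro j hj
        rw [Finset.mem_range] at hj
        have e : returnMap^[m + 1] x = x := by
          rw [← Nat.succ_eq_add_one, ← hm]
          exact iterate_minimalPeriod
        rw [e, if_neg (hmin _).not_gt, if_pos, sub_zero]
        exact lt_of_le_of_ne (hmin _) (hne 0 (j + 1) (by omega) (by omega))
    rw [hR] at ht
    rw [hm]
    push_cast
    rw [add_sub_cancel_right, ← ht]
    refine Finset.sum_congr rfl fun j hj => Finset.sum_congr rfl fun i hi => ?_
    rw [Finset.mem_range] at hi hj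
    have hij := hne i j hi (by omega)
    rw [iterate_succ_apply', iterate_succ_apply', crossing_sub_crossing
      (mem_branchSet (iterate_periodic hx i)) (mem_branchSet (iterate_periodic hx j))]
    exact fun h => hij (returnMap_inj (iterate_periodic hx i) (iterate_periodic hx j) h)
  have hsum : ∑ p ∈ leftPoints x, ∑ q ∈ rightPoints x,
      (if returnMap q < returnMap p then (1 : ℤ) else 0) =
      ∑ j ∈ Finset.range n, ∑ i ∈ Finset.range j,
      (crossing (returnMap^[i] x) (returnMap^[j] x) +
        crossing (returnMap^[j] x) (returnMap^[i] x)) := by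
    rw [← sum_range_sum_range (fun i j => crossing (returnMap^[i] x) (returnMap^[j] x))]
    · have e : ∀ φ : ℝ → ℤ, ∑ i ∈ Finset.range n, φ (returnMap^[i] x) = ∑ z ∈ orbitPoints x, φ z := by
        intro φ
        rw [orbitPoints, Finset.sum_image]
        rw [Finset.coe_range]
        exact hinj
      rw [e (fun z => ∑ j ∈ Finset.range n, crossing z (returnMap^[j] x)), leftPoints,
        Finset.sum_filter]
      refine Finset.sum_congr rfl fun p _ => ?_
      rw [e (crossing p), rightPoints, Finset.sum_filter]
      split_ifs with hp
      · refine Finset.sum_congr rfl fun q _ => ?_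
        simp only [crossing, Crosses, hp, true_and, ite_and]
      · exact (Finset.sum_eq_zero fun q _ => if_neg fun h => hp h.1).symm
    · intro i
      exact if_neg fun h => by linarith [h.1, h.2.1]
  rw [card_badPairs_eq_sum, hsum]
  simp only [Finset.sum_sub_distrib, Finset.sum_add_distrib] at hdiff ⊢
  linarith

/-! ### Unknotting a Lorenz knot -/

theorem edges_getElem?_map_range {α : Type} {N : ℕ} {v : ℕ → α} {i : ℕ} {e : α × α}
    (h : e ∈ (edges ((List.range N).map v))[i]?) : i < N ∧ e = (v i, v ((i + 1) % N)) := by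
  rw [edges_map_range, Option.mem_def, List.getElem?_eq_some_iff] at h
  obtain ⟨hi, rfl⟩ := h
  simp only [List.length_map, List.length_range] at hi
  exact ⟨hi, by simp⟩

/-- From its leftmost point, a Lorenz knot can be made descending by changing the crossings at which
the strand visited first is the lower one. -/
theorem exists_unknotsWith {x : ℝ} (hx : x ∈ periodicPts returnMap) :
    ∃ k ≤ (badPairs x).card, UnknotsWith (lorenzKnot x) k := by
  set N := 6 * minimalPeriod returnMap x with hN
  have hn0 : 0 < minimalPeriod returnMap x := minimalPeriod_pos_of_mem_periodicPts hx
  have hV0 : orbitVertex x N = orbitVertex x 0 := by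
    simpa using orbitVertex_add_period x 0
  -- The descent starts at the second vertex, so that the closing edge is the first edge of the
  -- orbit, which has no crossings.
  set V : ℕ → Space := fun i => orbitVertex x (i + 1) with hV
  have hD : (lorenzKnot x).rotate 1 = (List.range N).map V := by
    rw [lorenzKnot_eq, rotate_map_range (orbitVertex_add_period x)]
  have hdia : IsDiagram ((List.range N).map V) := hD ▸ (isDiagram_lorenzKnot hx).rotate
  obtain ⟨H, hNH, hknot, hunknot⟩ := exists_descends N (by omega) (fun i => (V i).1) (by
    intro i hi hiN hmem
    simp only [hV, zero_add] at hmem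
    rw [orbitVertex_succ x (i + 1)] at hmem
    rcases vertex_on_edge (iterate_periodic hx _) (iterate_periodic hx _)
      (Nat.mod_lt _ (by norm_num)) (Nat.mod_lt _ (by norm_num)) hmem with h | h
    · have := orbitVertex_fst_inj hx (i := i + 1) (j := 1) (by omega) (by omega)
        (by rw [orbitVertex, orbitVertex, h.1, h.2])
      omega
    · have h' : orbitVertex x 1 = orbitVertex x (i + 1 + 1) := by
        rw [orbitVertex_succ x (i + 1), ← h]
        rfl
      rcases Nat.lt_or_ge (i + 1 + 1) N with hlt | hge
      · have := orbitVertex_fst_inj hx (by omega) hlt (congrArg Prod.fst h')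
        omega
      · rw [show i + 1 + 1 = N by omega, hV0] at h'
        have := orbitVertex_fst_inj hx (by omega) (by omega) (congrArg Prod.fst h')
        omega)
  set D' := (List.range N).map (descendingVertex N (fun i => (V i).1) H) with hD'
  have hshadow : shadow D' = shadow ((List.range N).map V) := by
    simp [shadow, hD', descendingVertex]
  have hsub : changedCrossings ((List.range N).map V) D' ⊆
      ((badPairs x).image fun ij => (6 * ij.2 + 4, 6 * ij.1 + 4) : Finset (ℕ × ℕ)) := by
    rintro ⟨a, b⟩ ⟨⟨e, he, e', he', p, hp, q, hq, hpq, hlt⟩, ⟨d, hd, d', hd', r, hr, s, hs, -, hlt'⟩⟩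
    obtain ⟨ha, rfl⟩ := edges_getElem?_map_range he
    obtain ⟨hb, rfl⟩ := edges_getElem?_map_range he'
    obtain ⟨-, rfl⟩ := edges_getElem?_map_range hd
    obtain ⟨-, rfl⟩ := edges_getElem?_map_range hd'
    dsimp only at hp hq hr hs
    have hnext : ∀ i < N, V ((i + 1) % N) = orbitVertex x (i + 1 + 1) := by
      intro i hi
      rcases Nat.lt_or_ge (i + 1) N with h | h
      · rw [Nat.mod_eq_of_lt h]
      · have e : i + 1 = N := by omega
        rw [e, Nat.mod_self, add_comm N 1, orbitVertex_add_period]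
    rw [hnext _ ha, orbitVertex_succ] at hp
    rw [hnext _ hb, orbitVertex_succ] at hq
    have hc := stripCrossing_of_over (iterate_periodic hx _) (iterate_periodic hx _)
      (Nat.mod_lt _ (by norm_num)) (Nat.mod_lt _ (by norm_num)) hp hq hpq hlt
    have ha5 := hc.left_strip
    have hb5 := hc.right_strip
    rw [Nat.mod_eq_of_lt (by omega)] at hr hs
    have hba : b < a := by
      by_contra! hab
      have hne : a ≠ b := by
        rintro rfl
        linarith [hc.left, hc.right]
      have hheight : ∀ i, i + 1 < N → (descendingVertex N (fun i => (V i).1) H i).2 = -(i : ℝ) := by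
        intro i hi
        simp [descendingVertex, hi.ne]
      have hheight' : ∀ i, i + 1 < N →
          (descendingVertex N (fun i => (V i).1) H (i + 1)).2 ≤ -(i + 1 : ℝ) := by
        intro i hi
        rcases Nat.lt_or_ge (i + 1 + 1) N with h | h
        · rw [hheight _ h]
          push_cast
          exact le_rfl
        · have e : i + 1 + 1 = N := by omega
          have : ((i + 1 + 1 : ℕ) : ℝ) ≤ H := by rw [e]; exact hNH
          push_cast at this
          simp only [descendingVertex, e, if_true]
          linarith
      have h1 := hheight b (by omega)
      have h2 := hheight' b (by omega)
      have h3 := hheight a (by omega)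
      have h4 := hheight (a + 1) (by omega)
      have hr2 := snd_mem_of_mem_segment (by rw [h1]; linarith) hr
      have hs2 := snd_mem_of_mem_segment (by rw [h3, h4]; push_cast; linarith) hs
      have hcast : ((a + 1 : ℕ) : ℝ) ≤ b := by exact_mod_cast (by omega : a + 1 ≤ b)
      rw [h4] at hs2
      rw [h1] at hr2
      linarith [hr2.2.1, hs2.1]
    rw [Finset.mem_coe, Finset.mem_image]
    refine ⟨((b + 1) / 6, (a + 1) / 6), ?_, ?_⟩
    · simp only [badPairs, Finset.mem_filter, Finset.mem_product, Finset.mem_range]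
      exact ⟨⟨by omega, by omega⟩, by omega, hc.left, hc.right, hc.reverses⟩
    · ext <;> simp only <;> omega
  refine ⟨_, ?_, (List.range N).map V, D', hD ▸ KnotEquiv.rotate _ 1, hdia, ⟨hknot, ?_⟩, hshadow,
    rfl, hunknot⟩
  · calc (changedCrossings ((List.range N).map V) D').ncard
        ≤ (((badPairs x).image fun ij => (6 * ij.2 + 4, 6 * ij.1 + 4) :
            Finset (ℕ × ℕ)) : Set (ℕ × ℕ)).ncard := Set.ncard_le_ncard hsub (Finset.finite_toSet _)
      _ ≤ (badPairs x).card := by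
        rw [Set.ncard_coe_finset]
        exact Finset.card_image_le
  · rw [hshadow]
    exact hdia.2

theorem lorenzKnot_iterate (x : ℝ) (hx : x ∈ periodicPts returnMap) (i : ℕ) :
    lorenzKnot (returnMap^[i] x) = (lorenzKnot x).rotate (6 * i) := by
  rw [lorenzKnot_eq, lorenzKnot_eq, rotate_map_range (orbitVertex_add_period x),
    minimalPeriod_apply_iterate hx]
  simp only [orbitVertex_add]

theorem UnknotsWith.of_equiv {K K' : List Space} {k : ℕ} (h : UnknotsWith K' k)
    (hK : KnotEquiv K K') : UnknotsWith K k := by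
  obtain ⟨D, D', h1, h2⟩ := h
  exact ⟨D, D', .trans _ _ _ hK h1, h2⟩

end LorenzKnots

theorem theorem6p1 (x : ℝ) (hx : x ∈ Function.periodicPts LorenzKnots.returnMap) :
    LorenzKnots.IsPolygonalKnot (LorenzKnots.lorenzKnot x) ∧
    ∃ u : ℕ, LorenzKnots.unknottingNumber (LorenzKnots.lorenzKnot x) = (u : ℕ∞) ∧
      (u : ℚ) ≤ 1 / 2 *
        (((LorenzKnots.numLeft x : ℚ) + (LorenzKnots.numRight x : ℚ)) *
            ((LorenzKnots.tripNumber x : ℚ) - 1)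
          - ∑ i ∈ LorenzKnots.muIndices x, (i : ℚ)
          - ∑ i ∈ LorenzKnots.nuIndices x, (i : ℚ)
          + ((LorenzKnots.tripNumber x : ℚ) + 1)) := by
  open LorenzKnots in
  refine ⟨(isDiagram_lorenzKnot hx).1, ?_⟩
  -- The orbit is followed from its leftmost point.
  have hne : (orbitPoints x).Nonempty := ⟨x, (mem_orbitPoints hx).2 ⟨0, rfl⟩⟩
  obtain ⟨i, hi⟩ := (mem_orbitPoints hx).1 ((orbitPoints x).min'_mem hne)
  have hyper := iterate_periodic hx i
  have hO : orbitPoints (returnMap^[i] x) = orbitPoints x := orbitPoints_iterate hx i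
  have hL : leftPoints (returnMap^[i] x) = leftPoints x := by rw [leftPoints, hO, leftPoints]
  have hR : rightPoints (returnMap^[i] x) = rightPoints x := by rw [rightPoints, hO, rightPoints]
  obtain ⟨k, hk, hunk⟩ := exists_unknotsWith hyper
  have hunk' : UnknotsWith (lorenzKnot x) k := hunk.of_equiv (by
    rw [lorenzKnot_iterate x hx]
    exact KnotEquiv.rotate _ _)
  have hle : unknottingNumber (lorenzKnot x) ≤ k := iInf₂_le k hunk'
  obtain ⟨u, hu⟩ := ENat.ne_top_iff_exists.1 (ne_top_of_le_ne_top (ENat.natCast_ne_top k) hle)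
  refine ⟨u, hu.symm, ?_⟩
  have huk : u ≤ k := by
    rw [← hu] at hle
    exact_mod_cast hle
  have hcount := two_mul_card_badPairs hyper fun j =>
    hi.le.trans (Finset.min'_le _ _ ((mem_orbitPoints hx).2
      ⟨j + i, Function.iterate_add_apply _ _ _ _⟩))
  rw [hL, hR, crossings_eq hx, Function.minimalPeriod_apply_iterate hx] at hcount
  have hn : ((Function.minimalPeriod returnMap x : ℕ) : ℤ) = numLeft x + numRight x := by
    rw [← card_orbitPoints hx, orbitPoints, Finset.card_image_of_injOn, Finset.card_range]
    rw [Finset.coe_range]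
    exact Function.iterate_injOn_Iio_minimalPeriod
  rw [hn] at hcount
  have hcount' : (2 * ((badPairs (returnMap^[i] x)).card : ℚ) + (numLeft x + numRight x - 1)) =
      (tripNumber x : ℚ) * (numLeft x + numRight x + 1)
        - ∑ i ∈ muIndices x, (i : ℚ) - ∑ i ∈ nuIndices x, (i : ℚ) := by
    have h := congrArg (Int.cast : ℤ → ℚ) hcount
    push_cast at h
    exact h
  have hub : (u : ℚ) ≤ (badPairs (returnMap^[i] x)).card := by exact_mod_cast huk.trans hk
  linarith
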